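/- Let $\Bbbk$ be an algebraically closed field of characteristic zero, let $m$ be a positive integer, put $f=z(z+m)\in\Bbbk[z]$, and let $$A=A(f)=\Bbbk[z]\langle x,y\rangle\big/\big(xz=(z+1)x,\ yz=(z-1)y,\ xy=f(z),\ yx=f(z-1)\big),$$ $\mathbb Z$-graded by $\deg x=1$, $\deg y=-1$, $\deg z=0$. Let $\operatorname{gr}A$ be the category of finitely generated $\mathbb Z$-graded right $A$-modules with degree-preserving $A$-linear maps, and for $n\in\mathbb Z$ let $M\langle n\rangle$ be the shift of $M$, with $M\langle n\rangle_i=M_{i-n}$. Let $\operatorname{fdim}A\subseteq\operatorname{gr}A$ be the Serre subcategory of modules that are finite-dimensional over $\Bbbk$, let $\operatorname{qgr}A=\operatorname{gr}A/\operatorname{fdim}A$ be the quotient category (the localization of $\operatorname{gr}A$ at the morphisms with kernel and cokernel in $\operatorname{fdim}A$), and let $\pi:\operatorname{gr}A\to\operatorname{qgr}A$ be the quotient functor. Put $$X=\big(A/(x,z+m)A\big)\langle -m\rangle,\qquad Y=\big(A/(y,z-1)A\big)\langle 1\rangle .$$ A family of objects of a category generates an object $M$ if there is an epimorphism onto $M$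 from a finite direct sum of members of the family (repetitions allowed), and it generates the category if it generates every object. Let $\mathcal P=\{P_i\}_{i\in I}$ be a family of rank one projective modules in $\operatorname{gr}A$. If $\mathcal P$ generates $X\langle n\rangle$ and $Y\langle n\rangle$ for every $n\in\mathbb Z$, then $\{\pi P_i\}_{i\in I}$ generates $\operatorname{qgr}A$. Moreover (independently of any given family $\mathcal P$), $\operatorname{qgr}A$ has enough projectives: every object of $\operatorname{qgr}A$ is the target of an epimorphism from a projective object. -/

import Mathlib

open CategoryTheory

universe u v w

/-! ### Finitely generated graded right modules

Right modules over `R` are modules over `Rᵐᵒᵖ`; the right action `m · a` is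
`MulOpposite.op a • m`. -/

section Graded

variable {k : Type u} [Field k] {R : Type u} [Ring R] [Algebra k R]

/-- A finitely generated `ℤ`-graded right module over the `k`-algebra `R` with homogeneous
components `𝒜 i`. -/
structure GrMod (𝒜 : ℤ → Submodule k R) where
  carrier : Type u
  [addCommGroup : AddCommGroup carrier]
  [moduleBase : Module k carrier]
  [module : Module Rᵐᵒᵖ carrier]
  [isScalarTower : IsScalarTower k Rᵐᵒᵖ carrier]
  /-- the homogeneous components -/
  deg : ℤ → Submodule k carrier
  isInternal : DirectSum.IsInternal deg
  op_smul_mem : ∀ {i j : ℤ} {a : R} {m : carrier}, m ∈ deg i → a ∈ 𝒜 j →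
    MulOpposite.op a • m ∈ deg (i + j)
  finite : Module.Finite Rᵐᵒᵖ carrier

attribute [instance] GrMod.addCommGroup GrMod.moduleBase GrMod.module GrMod.isScalarTower

namespace GrMod

variable {𝒜 : ℤ → Submodule k R}

/-- Right `R`-linear maps of degree `0`. -/
@[ext]
structure Hom (M N : GrMod 𝒜) where
  toLinearMap : M.carrier →ₗ[Rᵐᵒᵖ] N.carrier
  map_mem : ∀ {i : ℤ} {m : M.carrier}, m ∈ M.deg i → toLinearMap m ∈ N.deg i

/-- The category `gr R` of finitely generated graded right `R`-modules. -/
instance : Category (GrMod 𝒜) where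
  Hom M N := Hom M N
  id M := ⟨LinearMap.id, fun h => h⟩
  comp f g := ⟨g.toLinearMap ∘ₗ f.toLinearMap, fun h => g.map_mem (f.map_mem h)⟩

/-- The underlying linear map of a morphism of `gr R`. -/
def lin {M N : GrMod 𝒜} (f : M ⟶ N) : M.carrier →ₗ[Rᵐᵒᵖ] N.carrier :=
  Hom.toLinearMap f

/-- The shift `M⟨n⟩`, with `M⟨n⟩_i = M_{i - n}`. -/
def shift (M : GrMod 𝒜) (n : ℤ) : GrMod 𝒜 where
  carrier := M.carrier
  deg i := M.deg (i - n)
  isInternal := by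
    have h := (DirectSum.isInternal_submodule_iff_iSupIndep_and_iSup_eq_top _).1 M.isInternal
    refine (DirectSum.isInternal_submodule_iff_iSupIndep_and_iSup_eq_top _).2 ⟨?_, ?_⟩
    · exact h.1.comp (f := fun i : ℤ => i - n) (fun a b hab => by simpa using hab)
    · rw [← h.2]
      exact (Equiv.subRight n).iSup_comp (g := M.deg)
  op_smul_mem {i j a m} hm ha := by
    have := M.op_smul_mem hm ha
    rwa [show i - n + j = i + j - n by ring] at this
  finite := M.finite

/-- The morphisms of `gr R` whose kernel and cokernel are finite-dimensional over `k`. -/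
def isoModFDim (𝒜 : ℤ → Submodule k R) : MorphismProperty (GrMod 𝒜) := fun _ N f =>
  Module.Finite k ((LinearMap.ker (lin f)).restrictScalars k) ∧
    Module.Finite k (N.carrier ⧸ (LinearMap.range (lin f)).restrictScalars k)

/-- The rank of `M` as a right `R`-module is one. -/
def IsRankOne (M : GrMod 𝒜) : Prop := Module.rank Rᵐᵒᵖ M.carrier = 1

end GrMod

/-- The quotient category `qgr R = gr R / fdim R` by the Serre subcategory of finite-dimensional
modules: the localization of `gr R` at the morphisms with kernel and cokernel in `fdim R`. -/
abbrev Qgr (𝒜 : ℤ → Submodule k R) := (GrMod.isoModFDim 𝒜).Localization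

/-- The quotient functor `π : gr R ⥤ qgr R`. -/
abbrev qgrπ (𝒜 : ℤ → Submodule k R) : GrMod 𝒜 ⥤ Qgr 𝒜 := (GrMod.isoModFDim 𝒜).Q

end Graded

/-! ### Generation -/

/-- The family of objects `P` generates the object `M`: there is an epimorphism to `M` from a
finite direct sum of members of `P` (with repetitions allowed). -/
def GeneratesObj {C : Type u} [Category.{v} C] {I : Type w} (P : I → C) (M : C) : Prop :=
  ∃ (n : ℕ) (s : Fin n → I) (c : Limits.Cofan fun j => P (s j)) (_ : Limits.IsColimit c)
    (f : c.pt ⟶ M), Epi f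

/-- The family of objects `P` generates the category `C`. -/
def GeneratesCat {C : Type u} [Category.{v} C] {I : Type w} (P : I → C) : Prop :=
  ∀ M : C, GeneratesObj P M

/-! ### Cyclic graded modules `A / S A` -/

section Cyclic

variable {k : Type u} [Field k] {R : Type u} [Ring R] [Algebra k R]
  (𝒜 : ℤ → Submodule k R) [GradedAlgebra 𝒜]

/-- The right ideal generated by homogeneous elements contains the homogeneous components of
its elements. -/
theorem proj_mem_span_op {S : Set R} (hS : ∀ s ∈ S, SetLike.IsHomogeneousElem 𝒜 s) (i : ℤ)
    {a : R} (ha : a ∈ Submodule.span Rᵐᵒᵖ S) :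
    GradedRing.proj 𝒜 i a ∈ Submodule.span Rᵐᵒᵖ S := by
  induction ha using Submodule.span_induction generalizing i with
  | mem s hs =>
    obtain ⟨d, hd⟩ := hS s hs
    rw [GradedRing.proj_apply]
    by_cases h : d = i
    · subst h
      rw [DirectSum.decompose_of_mem_same 𝒜 hd]
      exact Submodule.subset_span hs
    · rw [DirectSum.decompose_of_mem_ne 𝒜 hd h]
      exact Submodule.zero_mem _
  | zero => simp
  | add x y _ _ hx hy => rw [map_add]; exact add_mem (hx i) (hy i)
  | smul b x _ hx =>
    obtain ⟨b, rfl⟩ := MulOpposite.op_surjective b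
    rw [MulOpposite.smul_eq_mul_unop, MulOpposite.unop_op]
    induction b using DirectSum.Decomposition.inductionOn 𝒜 with
    | zero => simp
    | @homogeneous j b =>
      rw [GradedRing.proj_apply, show i = (i - j) + j by ring,
        DirectSum.coe_decompose_mul_add_of_right_mem 𝒜 b.2]
      have := Submodule.smul_mem (Submodule.span Rᵐᵒᵖ S) (MulOpposite.op (b : R)) (hx (i - j))
      rwa [MulOpposite.smul_eq_mul_unop, MulOpposite.unop_op] at this
    | add b c hb hc => rw [mul_add, map_add]; exact add_mem hb hc

/-- The graded right module `R / S R`, where `S` is a set of homogeneous elements. -/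
def cyclicGr (S : Set R) (hS : ∀ s ∈ S, SetLike.IsHomogeneousElem 𝒜 s) : GrMod 𝒜 where
  carrier := R ⧸ Submodule.span Rᵐᵒᵖ S
  deg i := (𝒜 i).map ((Submodule.span Rᵐᵒᵖ S).mkQ.restrictScalars k)
  isInternal := by
    rw [DirectSum.isInternal_submodule_iff_iSupIndep_and_iSup_eq_top]
    have h := (DirectSum.isInternal_submodule_iff_iSupIndep_and_iSup_eq_top _).1
      (DirectSum.Decomposition.isInternal 𝒜)
    refine ⟨?_, ?_⟩
    · intro i
      let J := Submodule.span Rᵐᵒᵖ S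
      let q : R ⧸ J →+ R ⧸ J :=
        QuotientAddGroup.map J.toAddSubgroup J.toAddSubgroup (GradedRing.proj 𝒜 i)
          (fun a ha => proj_mem_span_op 𝒜 hS i ha)
      have hq : ∀ a : R, q (J.mkQ a) = J.mkQ (GradedRing.proj 𝒜 i a) := fun a => rfl
      rw [Submodule.disjoint_def]
      intro x hx hx'
      have h1 : q x = x := by
        obtain ⟨a, ha, rfl⟩ := hx
        change q (J.mkQ a) = J.mkQ a
        rw [hq, GradedRing.proj_apply, DirectSum.decompose_of_mem_same 𝒜 ha]
      have h2 : ∀ y ∈ ⨆ j, ⨆ (_ : j ≠ i), (𝒜 j).map (J.mkQ.restrictScalars k), q y = 0 := by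
        intro y hy
        induction hy using Submodule.iSup_induction' with
        | mem j y hy =>
          by_cases hji : j = i
          · simp only [hji, ne_eq, not_true_eq_false, iSup_false, Submodule.mem_bot] at hy
            rw [hy, map_zero]
          · simp only [ne_eq, hji, not_false_eq_true, iSup_pos] at hy
            obtain ⟨a, ha, rfl⟩ := hy
            change q (J.mkQ a) = 0
            rw [hq, GradedRing.proj_apply, DirectSum.decompose_of_mem_ne 𝒜 ha hji, map_zero]
        | zero => exact map_zero q
        | add y z _ _ hy hz => rw [map_add, hy, hz, add_zero]
      exact h1.symm.trans (h2 x hx')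
    · refine (Submodule.map_iSup _ _).symm.trans ?_
      rw [h.2, Submodule.map_top]
      exact LinearMap.range_eq_top.2 (Submodule.mkQ_surjective (Submodule.span Rᵐᵒᵖ S))
  op_smul_mem := by
    rintro i j a _ ⟨m, hm, rfl⟩ ha
    exact ⟨m * a, SetLike.mul_mem_graded hm ha, rfl⟩
  finite := by
    have : Module.Finite Rᵐᵒᵖ R :=
      ⟨⟨{1}, eq_top_iff.2 fun a _ => by
        rw [Finset.coe_singleton, Submodule.mem_span_singleton]
        exact ⟨MulOpposite.op a, by simp⟩⟩⟩
    exact Module.Finite.of_surjective _ (Submodule.mkQ_surjective (Submodule.span Rᵐᵒᵖ S))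

end Cyclic

/-! ### Generalized Weyl algebras over `k[z]` -/

namespace GWA

open Polynomial

/-- The generators of a generalized Weyl algebra. -/
inductive Gen : Type u
  | x
  | y
  | z

/-- The degrees of the generators. -/
def Gen.wt : Gen.{u} → ℤ
  | .x => 1
  | .y => -1
  | .z => 0

variable {k : Type u} [Field k]

local notation "ι" => FreeAlgebra.ι k

/-- The relations `xz = σ(z)x`, `yz = σ⁻¹(z)y`, `xy = f`, `yx = σ⁻¹(f)`,
where `σ(z) = z + 1`. -/
inductive Rel (f : k[X]) : FreeAlgebra k Gen.{u} → FreeAlgebra k Gen.{u} → Prop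
  | xz : Rel f (ι Gen.x * ι Gen.z) ((ι Gen.z + 1) * ι Gen.x)
  | yz : Rel f (ι Gen.y * ι Gen.z) ((ι Gen.z - 1) * ι Gen.y)
  | xy : Rel f (ι Gen.x * ι Gen.y) (aeval (ι Gen.z) f)
  | yx : Rel f (ι Gen.y * ι Gen.x) (aeval (ι Gen.z) (f.comp (X - 1)))

end GWA

/-- The generalized Weyl algebra `A(f) = k[z](σ, f)` with `σ(z) = z + 1`. -/
abbrev GWA {k : Type u} [Field k] (f : Polynomial k) : Type u := RingQuot (GWA.Rel f)

namespace GWA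

open Polynomial

variable {k : Type u} [Field k] (f : k[X])

/-- The generators of `A(f)`. -/
def gen (g : Gen.{u}) : GWA f := RingQuot.mkAlgHom k (Rel f) (FreeAlgebra.ι k g)

/-- The grading of `A(f)` with `deg x = 1`, `deg y = -1`, `deg z = 0`: the component of degree `n`
is spanned by the words of degree `n` in the generators. -/
def grading (n : ℤ) : Submodule k (GWA f) :=
  Submodule.span k {a | ∃ l : List Gen.{u}, (l.map Gen.wt).sum = n ∧ (l.map (gen f)).prod = a}

theorem gen_mem (g : Gen.{u}) : gen f g ∈ grading f g.wt :=
  Submodule.subset_span ⟨[g], by simp, by simp⟩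

instance : SetLike.GradedMonoid (grading f) where
  one_mem := Submodule.subset_span ⟨[], by simp, by simp⟩
  mul_mem i j a b ha hb := by
    have h := Submodule.mul_mem_mul ha hb
    rw [grading, grading, Submodule.span_mul_span] at h
    refine Submodule.span_mono ?_ h
    rintro _ ⟨_, ⟨l, hl, rfl⟩, _, ⟨l', hl', rfl⟩, rfl⟩
    exact ⟨l ++ l', by simp [hl, hl'], by simp⟩

open DirectSum

/-- The algebra map sending each generator to itself in its degree. -/
noncomputable def toDirectSumFree : FreeAlgebra k Gen.{u} →ₐ[k] ⨁ i, grading f i :=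
  FreeAlgebra.lift k fun g => DirectSum.of (fun i => grading f i) g.wt ⟨gen f g, gen_mem f g⟩

theorem coe_toDirectSumFree (a : FreeAlgebra k Gen.{u}) :
    DirectSum.coeAlgHom (grading f) (toDirectSumFree f a) = RingQuot.mkAlgHom k (Rel f) a := by
  have : (DirectSum.coeAlgHom (grading f)).comp (toDirectSumFree f) =
      RingQuot.mkAlgHom k (Rel f) := by
    ext g
    simp [toDirectSumFree, gen]
  exact DFunLike.congr_fun this a

/-- `u` lies in the component of degree `d` of the direct sum. -/
def IsHom (d : ℤ) (u : ⨁ i, grading f i) : Prop :=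
  ∃ t : grading f d, u = DirectSum.of (fun i => grading f i) d t

variable {f}

theorem IsHom.mul {d e n : ℤ} {u v : ⨁ i, grading f i} (hu : IsHom f d u) (hv : IsHom f e v)
    (hn : d + e = n) : IsHom f n (u * v) := by
  subst hn
  obtain ⟨s, rfl⟩ := hu
  obtain ⟨t, rfl⟩ := hv
  exact ⟨_, DirectSum.of_mul_of _ _⟩

theorem IsHom.add {d : ℤ} {u v : ⨁ i, grading f i} (hu : IsHom f d u) (hv : IsHom f d v) :
    IsHom f d (u + v) := by
  obtain ⟨s, rfl⟩ := hu
  obtain ⟨t, rfl⟩ := hv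
  exact ⟨s + t, (map_add _ _ _).symm⟩

theorem IsHom.algebraMap (c : k) : IsHom f 0 (algebraMap k (⨁ i, grading f i) c) :=
  ⟨_, DirectSum.algebraMap_apply ..⟩

theorem IsHom.one : IsHom f 0 1 := ⟨_, rfl⟩

theorem IsHom.aeval {u : ⨁ i, grading f i} (hu : IsHom f 0 u) (p : k[X]) :
    IsHom f 0 (aeval u p) := by
  induction p using Polynomial.induction_on' with
  | add p q hp hq => rw [map_add]; exact hp.add hq
  | monomial n c =>
    rw [aeval_monomial]
    have : IsHom f 0 (u ^ n) := by
      induction n with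
      | zero => rw [pow_zero]; exact .one
      | succ n ih => rw [pow_succ]; exact ih.mul hu (add_zero 0)
    exact (IsHom.algebraMap c).mul this (add_zero 0)

theorem IsHom.eq {d : ℤ} {u v : ⨁ i, grading f i} (hu : IsHom f d u) (hv : IsHom f d v)
    (h : DirectSum.coeAlgHom (grading f) u = DirectSum.coeAlgHom (grading f) v) : u = v := by
  obtain ⟨s, rfl⟩ := hu
  obtain ⟨t, rfl⟩ := hv
  rw [DirectSum.coeAlgHom_of, DirectSum.coeAlgHom_of] at h
  rw [Subtype.ext h]

theorem isHom_gen (g : Gen.{u}) : IsHom f g.wt (toDirectSumFree f (FreeAlgebra.ι k g)) :=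
  ⟨_, FreeAlgebra.lift_ι_apply _ _⟩

theorem isHom_aeval_z (p : k[X]) :
    IsHom f 0 (toDirectSumFree f (Polynomial.aeval (FreeAlgebra.ι k Gen.z) p)) := by
  rw [← Polynomial.aeval_algHom_apply]
  exact (isHom_gen Gen.z).aeval p

theorem toDirectSumFree_rel {a b : FreeAlgebra k Gen.{u}} (h : Rel f a b) :
    toDirectSumFree f a = toDirectSumFree f b := by
  suffices H : ∃ d, IsHom f d (toDirectSumFree f a) ∧ IsHom f d (toDirectSumFree f b) by
    obtain ⟨d, ha, hb⟩ := H
    refine ha.eq hb ?_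
    rw [coe_toDirectSumFree, coe_toDirectSumFree]
    exact RingQuot.mkAlgHom_rel k h
  cases h with
  | xz =>
    refine ⟨1, ?_, ?_⟩
    · rw [map_mul]; exact (isHom_gen Gen.x).mul (isHom_gen Gen.z) (by simp [Gen.wt])
    · rw [map_mul, map_add, map_one]
      exact IsHom.mul (d := 0) ((isHom_gen Gen.z).add .one) (isHom_gen Gen.x) (by simp [Gen.wt])
  | yz =>
    refine ⟨-1, ?_, ?_⟩
    · rw [map_mul]; exact (isHom_gen Gen.y).mul (isHom_gen Gen.z) (by simp [Gen.wt])
    · rw [show (FreeAlgebra.ι k Gen.z - 1 : FreeAlgebra k Gen.{u}) =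
          FreeAlgebra.ι k Gen.z + algebraMap k _ (-1) by rw [map_neg, map_one, sub_eq_add_neg],
        map_mul, map_add, AlgHom.commutes]
      exact IsHom.mul (d := 0) ((isHom_gen Gen.z).add (.algebraMap _)) (isHom_gen Gen.y)
        (by simp [Gen.wt])
  | xy =>
    refine ⟨0, ?_, isHom_aeval_z _⟩
    rw [map_mul]; exact (isHom_gen Gen.x).mul (isHom_gen Gen.y) (by simp [Gen.wt])
  | yx =>
    refine ⟨0, ?_, isHom_aeval_z _⟩
    rw [map_mul]; exact (isHom_gen Gen.y).mul (isHom_gen Gen.x) (by simp [Gen.wt])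

variable (f)

/-- The decomposition of `A(f)` into homogeneous components. -/
noncomputable def toDirectSum : GWA f →ₐ[k] ⨁ i, grading f i :=
  RingQuot.liftAlgHom k ⟨toDirectSumFree f, fun _ _ h => toDirectSumFree_rel h⟩

theorem toDirectSum_gen (g : Gen.{u}) : toDirectSum f (gen f g) =
    DirectSum.of (fun i => grading f i) g.wt ⟨gen f g, gen_mem f g⟩ := by
  refine (RingQuot.liftAlgHom_mkAlgHom_apply k (toDirectSumFree f) (s := Rel f)
    (fun _ _ h => toDirectSumFree_rel h) (FreeAlgebra.ι k g)).trans ?_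
  exact FreeAlgebra.lift_ι_apply _ _

theorem coe_toDirectSum (a : GWA f) :
    DirectSum.coeAlgHom (grading f) (toDirectSum f a) = a := by
  obtain ⟨a, rfl⟩ := RingQuot.mkAlgHom_surjective k (Rel f) a
  rw [toDirectSum, RingQuot.liftAlgHom_mkAlgHom_apply, coe_toDirectSumFree]

theorem isHom_toDirectSum {n : ℤ} {a : GWA f} (ha : a ∈ grading f n) :
    IsHom f n (toDirectSum f a) := by
  induction ha using Submodule.span_induction with
  | mem a h =>
    obtain ⟨l, rfl, rfl⟩ := h
    induction l with
    | nil => simpa using IsHom.one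
    | cons g l ih =>
      simp only [List.map_cons, List.sum_cons, List.prod_cons, map_mul]
      exact IsHom.mul ⟨_, toDirectSum_gen f g⟩ ih rfl
  | zero => exact ⟨0, by simp⟩
  | add a b _ _ ha hb => rw [map_add]; exact ha.add hb
  | smul c a _ ha =>
    rw [Algebra.smul_def, map_mul, AlgHom.commutes]
    exact (IsHom.algebraMap c).mul ha (zero_add _)

noncomputable instance : GradedAlgebra (grading f) :=
  GradedAlgebra.ofAlgHom _ (toDirectSum f) (AlgHom.ext (coe_toDirectSum f)) fun i a => by
    refine (isHom_toDirectSum f a.2).eq ⟨a, rfl⟩ ?_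
    rw [coe_toDirectSum, DirectSum.coeAlgHom_of]

/-! ### The graded simple modules `X` and `Y` of `A(z(z+m))`, `m ≥ 1` -/

theorem isHom_z_add (c : k) :
    SetLike.IsHomogeneousElem (grading f) (gen f Gen.z + algebraMap k _ c) := by
  refine ⟨0, add_mem (gen_mem f Gen.z) ?_⟩
  exact SetLike.algebraMap_mem_graded (grading f) c

theorem isHom_x : SetLike.IsHomogeneousElem (grading f) (gen f Gen.x) := ⟨_, gen_mem f _⟩

theorem isHom_y : SetLike.IsHomogeneousElem (grading f) (gen f Gen.y) := ⟨_, gen_mem f _⟩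

variable (k)

/-- The polynomial `z(z + m)`. -/
noncomputable def quad (m : ℕ) : k[X] := X * (X + C (m : k))

/-- `X = (A / (x, z + m)A)⟨-m⟩`. -/
noncomputable def simpleX (m : ℕ) : GrMod (grading (quad k m)) :=
  (cyclicGr (grading (quad k m))
    {gen _ Gen.x, gen _ Gen.z + algebraMap k _ (m : k)}
    (by rintro s (rfl | rfl); exacts [isHom_x _, isHom_z_add _ _])).shift (-m)

/-- `Y = (A / (y, z - 1)A)⟨1⟩`. -/
noncomputable def simpleY (m : ℕ) : GrMod (grading (quad k m)) :=
  (cyclicGr (grading (quad k m))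
    {gen _ Gen.y, gen _ Gen.z + algebraMap k _ (-1)}
    (by rintro s (rfl | rfl); exacts [isHom_y _, isHom_z_add _ _])).shift 1

end GWA

/-! On a graded right module let w act on the component of degree n as z - n. The relations xz =
(z+1)x and yz = (z-1)y make w an A-linear, degree-preserving, natural endomorphism (`wOp`). Hence
every graded module is a k[w]-module, each component is finitely generated over k[w]
(`exists_eq_sum_wPoly`), and modules can be examined one eigenvalue of w at a time. Where w is a
scalar c, z acts on degree n as c + n, and going from degree n to n + 1 by x and back by y
multiplies by (c+n)(c+n+m). For c not an integer this never vanishes. For c = l an integer it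
vanishes exactly at n = -l and n = -l-m, which cuts the module into a left tail (shifts of X), a
finite window, and a right tail (shifts of Y).

Call V trivial for a family of projectives if no member maps to it nontrivially; projectivity makes
this pass to quotients of V. Suppose that trivial modules contain no generator of a left or right
tail and that those on which w is a nonintegral scalar vanish (`Detects`). If V is trivial, then
V/(w - 1/2)V = 0, so Nakayama's lemma gives a nonzero polynomial in w killing V; filtering by its
roots reduces to scalar w, where only the finite window survives. So trivial modules are
finite-dimensional (`Detects.finDim`). For any M, the quotient by the sum of all images of the
family is trivial, and finitely many of these images already have finite-dimensional cokernel
(`Detects.exists_finDim_coker`). Such a map becomes an epimorphism in the quotient category.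

A family generating all shifts of X and Y satisfies the two tail conditions at once. The nonintegral
condition holds for any nonzero projective P: otherwise P = (w - c)P, impossible by degree in a
summand of a free module (`eq_zero_of_projective`).

For enough projectives, a projective of gr A without nonzero maps to finite-dimensional modules
stays projective in qgr A (`projective_qgrπ_obj`). The modules `tailProj` have this property and
form a detecting family. They are cut out of a free module of rank two by an idempotent, which comes
from a Bézout identity between two coprime factors of the polynomial giving the action of x^m y^m.
-/

namespace GrMod

/-! ### Homogeneous components of graded modules -/

section Graded

variable {k : Type u} [Field k] {R : Type u} [Ring R] [Algebra k R] {𝒜 : ℤ → Submodule k R}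

/-- A criterion for internal direct sums in terms of projections. -/
theorem isInternal_of_proj {C : Type*} [AddCommGroup C] [Module k C] (D : ℤ → Submodule k C)
    (q : ℤ → C →+ C) (hq : ∀ n, ∀ v ∈ D n, q n v = v)
    (hq' : ∀ m n, m ≠ n → ∀ v ∈ D m, q n v = 0) (htop : ∀ v, v ∈ ⨆ n, D n) :
    DirectSum.IsInternal D := by
  rw [DirectSum.isInternal_submodule_iff_iSupIndep_and_iSup_eq_top]
  refine ⟨fun i => ?_, eq_top_iff.2 fun v _ => htop v⟩
  rw [Submodule.disjoint_def]
  intro x hx hx'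
  rw [← hq i x hx]
  refine Submodule.iSup_induction _ (motive := fun y => q i y = 0) hx' (fun j y hy => ?_)
    (map_zero _) fun y z hy hz => by rw [map_add, hy, hz, add_zero]
  by_cases hji : j = i
  · simp only [hji, ne_eq, not_true_eq_false, iSup_false, Submodule.mem_bot] at hy
    rw [hy, map_zero]
  · simp only [ne_eq, hji, not_false_eq_true, iSup_pos] at hy
    exact hq' j i hji y hy

noncomputable instance (M : GrMod 𝒜) : DirectSum.Decomposition M.deg :=
  M.isInternal.chooseDecomposition

/-- The projection to the component of degree `n`. -/
noncomputable def proj (M : GrMod 𝒜) (n : ℤ) : M.carrier →ₗ[k] M.carrier :=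
  (M.deg n).subtype ∘ₗ DirectSum.component k ℤ _ n ∘ₗ
    (DirectSum.decomposeLinearEquiv M.deg).toLinearMap

theorem proj_apply (M : GrMod 𝒜) (n : ℤ) (v : M.carrier) :
    M.proj n v = DirectSum.decompose M.deg v n := rfl

theorem proj_mem (M : GrMod 𝒜) (n : ℤ) (v : M.carrier) : M.proj n v ∈ M.deg n :=
  (DirectSum.decompose M.deg v n).2

theorem proj_of_mem {M : GrMod 𝒜} {n : ℤ} {v : M.carrier} (hv : v ∈ M.deg n) :
    M.proj n v = v := by
  rw [proj_apply, DirectSum.decompose_of_mem_same _ hv]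

theorem proj_of_mem_ne {M : GrMod 𝒜} {m n : ℤ} (h : m ≠ n) {v : M.carrier} (hv : v ∈ M.deg m) :
    M.proj n v = 0 := by
  rw [proj_apply, DirectSum.decompose_of_mem_ne _ hv h]

theorem mem_iSup_deg (M : GrMod 𝒜) (v : M.carrier) : v ∈ ⨆ n, M.deg n := by
  rw [M.isInternal.submodule_iSup_eq_top]
  trivial

theorem induction_on {M : GrMod 𝒜} {p : M.carrier → Prop} (v : M.carrier)
    (hom : ∀ n, ∀ v ∈ M.deg n, p v) (add : ∀ v w, p v → p w → p (v + w)) : p v :=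
  Submodule.iSup_induction M.deg (motive := p) (M.mem_iSup_deg v) hom (hom 0 0 (zero_mem _)) add

theorem exists_finset_sum_proj {M : GrMod 𝒜} (v : M.carrier) :
    ∃ s : Finset ℤ, ∑ n ∈ s, M.proj n v = v := by
  classical
  exact ⟨_, DirectSum.sum_support_decompose M.deg v⟩

theorem eq_zero_of_proj {M : GrMod 𝒜} {v : M.carrier} (h : ∀ n, M.proj n v = 0) : v = 0 := by
  obtain ⟨s, hs⟩ := exists_finset_sum_proj v
  rw [← hs]
  exact Finset.sum_eq_zero fun n _ => h n

theorem exists_mem_deg_ne_zero {M : GrMod 𝒜} {v : M.carrier} (h : v ≠ 0) :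
    ∃ n, ∃ e ∈ M.deg n, e ≠ 0 := by
  by_contra! H
  exact h (eq_zero_of_proj fun n => H n _ (M.proj_mem n v))

theorem proj_op_smul {M : GrMod 𝒜} {j : ℤ} {a : R} (ha : a ∈ 𝒜 j) (n : ℤ) (v : M.carrier) :
    M.proj n (MulOpposite.op a • v) = MulOpposite.op a • M.proj (n - j) v := by
  induction v using induction_on with
  | hom i v hv =>
    by_cases h : i + j = n
    · subst h
      rw [proj_of_mem (M.op_smul_mem hv ha), proj_of_mem (by simpa using hv)]
    · rw [proj_of_mem_ne h (M.op_smul_mem hv ha),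
        proj_of_mem_ne (fun h' => h (by rw [h']; ring)) hv, smul_zero]
  | add v w hv hw => rw [smul_add, map_add, map_add, hv, hw, smul_add]

/-! ### Morphisms -/

theorem hom_ext {M N : GrMod 𝒜} {f g : M ⟶ N} (h : ∀ v, lin f v = lin g v) : f = g :=
  Hom.ext (LinearMap.ext h)

theorem lin_injective {M N : GrMod 𝒜} : Function.Injective (lin : (M ⟶ N) → _) :=
  fun _ _ h => Hom.ext h

@[simp] theorem lin_comp {M N L : GrMod 𝒜} (f : M ⟶ N) (g : N ⟶ L) :
    lin (f ≫ g) = lin g ∘ₗ lin f := rfl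

theorem lin_mem {M N : GrMod 𝒜} (f : M ⟶ N) {i : ℤ} {v : M.carrier} (h : v ∈ M.deg i) :
    lin f v ∈ N.deg i := Hom.map_mem f h

/-- The morphism with a given underlying linear map. -/
def mkHom {M N : GrMod 𝒜} (f : M.carrier →ₗ[Rᵐᵒᵖ] N.carrier)
    (h : ∀ i, ∀ v ∈ M.deg i, f v ∈ N.deg i) : M ⟶ N := ⟨f, fun hv => h _ _ hv⟩

@[simp] theorem lin_mkHom {M N : GrMod 𝒜} (f : M.carrier →ₗ[Rᵐᵒᵖ] N.carrier)
    (h : ∀ i, ∀ v ∈ M.deg i, f v ∈ N.deg i) : lin (mkHom (M := M) (N := N) f h) = f := rfl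

theorem lin_smul {M N : GrMod 𝒜} (f : M ⟶ N) (c : k) (v : M.carrier) :
    lin f (c • v) = c • lin f v := by
  rw [← algebraMap_smul Rᵐᵒᵖ c v, ← algebraMap_smul Rᵐᵒᵖ c (lin f v), map_smul]

/-- The underlying `k`-linear map of a morphism. -/
def klin {M N : GrMod 𝒜} (f : M ⟶ N) : M.carrier →ₗ[k] N.carrier where
  toFun := lin f
  map_add' := map_add _
  map_smul' := lin_smul f

theorem lin_proj {M N : GrMod 𝒜} (f : M ⟶ N) (n : ℤ) (v : M.carrier) :
    lin f (M.proj n v) = N.proj n (lin f v) := by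
  induction v using induction_on with
  | hom i v hv =>
    by_cases h : i = n
    · subst h
      rw [proj_of_mem hv, proj_of_mem (lin_mem f hv)]
    · rw [proj_of_mem_ne h hv, proj_of_mem_ne h (lin_mem f hv), map_zero]
  | add v w hv hw => rw [map_add, map_add, hv, hw, map_add, map_add]

section Preadditive

variable {M N : GrMod 𝒜}

instance : Zero (M ⟶ N) := ⟨mkHom 0 fun _ _ _ => zero_mem _⟩
instance : Add (M ⟶ N) :=
  ⟨fun f g => mkHom (lin f + lin g) fun _ _ hv => add_mem (lin_mem f hv) (lin_mem g hv)⟩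
instance : Neg (M ⟶ N) := ⟨fun f => mkHom (-lin f) fun _ _ hv => neg_mem (lin_mem f hv)⟩
instance : Sub (M ⟶ N) :=
  ⟨fun f g => mkHom (lin f - lin g) fun _ _ hv => sub_mem (lin_mem f hv) (lin_mem g hv)⟩
instance : SMul ℕ (M ⟶ N) :=
  ⟨fun n f => mkHom (n • lin f) fun _ _ hv => nsmul_mem (lin_mem f hv) n⟩
instance : SMul ℤ (M ⟶ N) :=
  ⟨fun n f => mkHom (n • lin f) fun _ _ hv => zsmul_mem (lin_mem f hv) n⟩

instance : AddCommGroup (M ⟶ N) :=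
  lin_injective.addCommGroup (lin : (M ⟶ N) → _) rfl (fun _ _ => rfl) (fun _ => rfl)
    (fun _ _ => rfl) (fun _ _ => rfl) (fun _ _ => rfl)

@[simp] theorem lin_zero : lin (0 : M ⟶ N) = 0 := rfl
@[simp] theorem lin_add (f g : M ⟶ N) : lin (f + g) = lin f + lin g := rfl

instance : Preadditive (GrMod 𝒜) where
  add_comp _ _ _ f g h := hom_ext fun v => by simp
  comp_add _ _ _ f g h := hom_ext fun v => by simp

end Preadditive

theorem lin_sum {M N : GrMod 𝒜} {J : Type*} (s : Finset J) (f : J → (M ⟶ N)) :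
    lin (∑ j ∈ s, f j) = ∑ j ∈ s, lin (f j) :=
  map_sum (AddMonoidHom.mk' (lin : (M ⟶ N) → _) fun _ _ => rfl) f s

theorem epi_of_surjective {M N : GrMod 𝒜} (f : M ⟶ N) (h : Function.Surjective (lin f)) :
    Epi f := by
  refine ⟨fun a b hab => hom_ext fun v => ?_⟩
  obtain ⟨w, rfl⟩ := h v
  exact LinearMap.congr_fun (congrArg lin hab) w

/-! ### Homogeneous submodules and quotients -/

/-- A submodule which contains the homogeneous components of its elements. -/
def IsHomog (M : GrMod 𝒜) (N : Submodule Rᵐᵒᵖ M.carrier) : Prop :=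
  ∀ n, ∀ v ∈ N, M.proj n v ∈ N

theorem isHomog_range {M N : GrMod 𝒜} (f : M ⟶ N) : N.IsHomog (LinearMap.range (lin f)) := by
  rintro n _ ⟨v, rfl⟩
  exact ⟨M.proj n v, lin_proj f n v⟩

theorem isHomog_iSup {M : GrMod 𝒜} {J : Sort*} {N : J → Submodule Rᵐᵒᵖ M.carrier}
    (h : ∀ j, M.IsHomog (N j)) : M.IsHomog (⨆ j, N j) := by
  intro n v hv
  induction hv using Submodule.iSup_induction' with
  | mem j v hv => exact Submodule.mem_iSup_of_mem j (h j n v hv)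
  | zero => rw [map_zero]; exact zero_mem _
  | add v w _ _ hv hw => rw [map_add]; exact add_mem hv hw

/-- The quotient by a homogeneous submodule. -/
noncomputable def quot (M : GrMod 𝒜) (N : Submodule Rᵐᵒᵖ M.carrier) (hN : M.IsHomog N) :
    GrMod 𝒜 where
  carrier := M.carrier ⧸ N
  deg n := (M.deg n).map (N.mkQ.restrictScalars k)
  isInternal := by
    let q (n : ℤ) : M.carrier ⧸ N →+ M.carrier ⧸ N :=
      QuotientAddGroup.map N.toAddSubgroup N.toAddSubgroup (M.proj n).toAddMonoidHom
        (fun a ha => hN n a ha)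
    have hq : ∀ n v, q n (N.mkQ v) = N.mkQ (M.proj n v) := fun _ _ => rfl
    refine isInternal_of_proj _ q ?_ ?_ ?_
    · rintro n _ ⟨v, hv, rfl⟩
      exact (hq n v).trans (by rw [proj_of_mem hv]; rfl)
    · rintro m n h _ ⟨v, hv, rfl⟩
      exact (hq n v).trans (by rw [proj_of_mem_ne h hv, map_zero])
    · intro v
      obtain ⟨v, rfl⟩ := N.mkQ_surjective v
      rw [← Submodule.map_iSup]
      exact ⟨v, M.mem_iSup_deg v, rfl⟩
  op_smul_mem := by
    rintro i j a _ ⟨v, hv, rfl⟩ ha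
    exact ⟨_, M.op_smul_mem hv ha, rfl⟩
  finite := by
    have := M.finite
    exact Module.Finite.of_surjective _ N.mkQ_surjective

/-- The projection to a quotient. -/
noncomputable def quotMk (M : GrMod 𝒜) (N : Submodule Rᵐᵒᵖ M.carrier) (hN : M.IsHomog N) :
    M ⟶ M.quot N hN := mkHom (N := M.quot N hN) N.mkQ fun _ v hv => ⟨v, hv, rfl⟩

theorem lin_quotMk_surjective (M : GrMod 𝒜) (N : Submodule Rᵐᵒᵖ M.carrier) (hN : M.IsHomog N) :
    Function.Surjective (lin (M.quotMk N hN)) := N.mkQ_surjective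

theorem lin_quotMk_eq_zero {M : GrMod 𝒜} {N : Submodule Rᵐᵒᵖ M.carrier} {hN : M.IsHomog N}
    {v : M.carrier} : lin (M.quotMk N hN) v = 0 ↔ v ∈ N := Submodule.Quotient.mk_eq_zero N

/-- Morphisms out of a quotient. -/
noncomputable def quotLift {M L : GrMod 𝒜} (N : Submodule Rᵐᵒᵖ M.carrier) (hN : M.IsHomog N)
    (f : M ⟶ L) (hf : ∀ v ∈ N, lin f v = 0) : M.quot N hN ⟶ L :=
  mkHom (M := M.quot N hN) (N.liftQ (lin f) hf) (by
    rintro i _ ⟨v, hv, rfl⟩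
    exact lin_mem f hv)

/-- A finitely generated homogeneous submodule. -/
noncomputable def sub (M : GrMod 𝒜) (N : Submodule Rᵐᵒᵖ M.carrier) (hN : M.IsHomog N)
    (hfg : Module.Finite Rᵐᵒᵖ N) : GrMod 𝒜 where
  carrier := N
  deg n := (M.deg n).comap (N.subtype.restrictScalars k)
  isInternal := by
    refine isInternal_of_proj _ (fun n => AddMonoidHom.mk' (fun v => ⟨M.proj n v, hN n v v.2⟩)
      fun v w => Subtype.ext (map_add _ _ _)) ?_ ?_ ?_
    · exact fun n v hv => Subtype.ext (proj_of_mem hv)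
    · exact fun m n h v hv => Subtype.ext (proj_of_mem_ne h hv)
    · intro v
      obtain ⟨s, hs⟩ := exists_finset_sum_proj (v : M.carrier)
      have : v = ∑ n ∈ s, (⟨M.proj n v, hN n v v.2⟩ : N) :=
        Subtype.ext (by rw [AddSubmonoidClass.coe_finsetSum]; exact hs.symm)
      rw [this]
      exact sum_mem fun n _ => Submodule.mem_iSup_of_mem n (M.proj_mem n v)
  op_smul_mem := fun hv ha => M.op_smul_mem hv ha
  finite := hfg

/-- The inclusion of a submodule. -/
noncomputable def subι (M : GrMod 𝒜) (N : Submodule Rᵐᵒᵖ M.carrier) (hN : M.IsHomog N)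
    (hfg : Module.Finite Rᵐᵒᵖ N) : M.sub N hN hfg ⟶ M :=
  mkHom (M := M.sub N hN hfg) N.subtype fun _ _ hv => hv

/-- The corestriction of a morphism to a submodule. -/
noncomputable def subLift {M L : GrMod 𝒜} (N : Submodule Rᵐᵒᵖ M.carrier) (hN : M.IsHomog N)
    (hfg : Module.Finite Rᵐᵒᵖ N) (f : L ⟶ M) (hf : ∀ v, lin f v ∈ N) : L ⟶ M.sub N hN hfg :=
  mkHom (N := M.sub N hN hfg) ((lin f).codRestrict N hf) fun _ _ hv => lin_mem f hv

theorem subLift_subι {M L : GrMod 𝒜} (N : Submodule Rᵐᵒᵖ M.carrier) (hN : M.IsHomog N)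
    (hfg : Module.Finite Rᵐᵒᵖ N) (f : L ⟶ M) (hf : ∀ v, lin f v ∈ N) :
    subLift N hN hfg f hf ≫ M.subι N hN hfg = f := hom_ext fun _ => rfl

theorem finite_range {M N : GrMod 𝒜} (f : M ⟶ N) :
    Module.Finite Rᵐᵒᵖ (LinearMap.range (lin f)) :=
  have := M.finite
  Module.Finite.range _

/-- The image of a morphism. -/
noncomputable def range {M N : GrMod 𝒜} (f : M ⟶ N) : GrMod 𝒜 :=
  N.sub _ (isHomog_range f) (finite_range f)

/-- The surjection to the image of a morphism. -/
noncomputable def toRange {M N : GrMod 𝒜} (f : M ⟶ N) : M ⟶ range f :=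
  subLift _ (isHomog_range f) (finite_range f) f fun v => ⟨v, rfl⟩

/-- The inclusion of the image of a morphism. -/
noncomputable def rangeι {M N : GrMod 𝒜} (f : M ⟶ N) : range f ⟶ N :=
  N.subι _ (isHomog_range f) (finite_range f)

theorem lin_toRange_surjective {M N : GrMod 𝒜} (f : M ⟶ N) :
    Function.Surjective (lin (toRange f)) := by
  rintro ⟨_, v, rfl⟩
  exact ⟨v, rfl⟩

theorem lin_rangeι_injective {M N : GrMod 𝒜} (f : M ⟶ N) :
    Function.Injective (lin (rangeι f)) := (LinearMap.range (lin f)).injective_subtype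

theorem toRange_rangeι {M N : GrMod 𝒜} (f : M ⟶ N) : toRange f ≫ rangeι f = f :=
  hom_ext fun _ => rfl

/-- The cokernel of a morphism. -/
noncomputable def coker {M N : GrMod 𝒜} (f : M ⟶ N) : GrMod 𝒜 := N.quot _ (isHomog_range f)

/-- The projection to the cokernel. -/
noncomputable def cokerπ {M N : GrMod 𝒜} (f : M ⟶ N) : N ⟶ coker f := N.quotMk _ (isHomog_range f)

theorem lin_cokerπ_surjective {M N : GrMod 𝒜} (f : M ⟶ N) :
    Function.Surjective (lin (cokerπ f)) := lin_quotMk_surjective _ _ _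

theorem comp_cokerπ {M N : GrMod 𝒜} (f : M ⟶ N) : f ≫ cokerπ f = 0 :=
  hom_ext fun v => lin_quotMk_eq_zero.2 ⟨v, rfl⟩

theorem surjective_of_epi {M N : GrMod 𝒜} (f : M ⟶ N) [Epi f] :
    Function.Surjective (lin f) := by
  have h : cokerπ f = 0 := by rw [← cancel_epi f, comp_cokerπ, Limits.comp_zero]
  intro v
  have : lin (cokerπ f) v = 0 := by rw [h]; rfl
  exact lin_quotMk_eq_zero.1 this

/-- A morphism from a projective object lifts along a morphism whose image contains its image. -/
theorem exists_lift {P M N : GrMod 𝒜} [Projective P] (e : M ⟶ N) (g : P ⟶ N)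
    (h : ∀ v, lin g v ∈ LinearMap.range (lin e)) : ∃ g' : P ⟶ M, g' ≫ e = g := by
  have := epi_of_surjective _ (lin_toRange_surjective e)
  let g₁ : P ⟶ range e := subLift _ (isHomog_range e) (finite_range e) g h
  refine ⟨Projective.factorThru g₁ (toRange e), ?_⟩
  have h₁ := Projective.factorThru_comp g₁ (toRange e)
  calc _ = (Projective.factorThru g₁ (toRange e) ≫ toRange e) ≫ rangeι e := rfl
    _ = g := by rw [h₁]; exact subLift_subι _ _ _ _ _

/-! ### Finite direct sums -/

/-- The direct sum of a finite family. -/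
noncomputable def pi {J : Type} [Finite J] (M : J → GrMod 𝒜) : GrMod 𝒜 where
  carrier := ∀ j, (M j).carrier
  deg n := Submodule.pi Set.univ fun j => (M j).deg n
  isInternal := by
    classical
    have := Fintype.ofFinite J
    refine isInternal_of_proj _ (fun n => AddMonoidHom.mk' (fun v j => (M j).proj n (v j))
      fun v w => funext fun j => map_add _ _ _) ?_ ?_ ?_
    · exact fun n v hv => funext fun j => proj_of_mem (hv j trivial)
    · exact fun m n h v hv => funext fun j => proj_of_mem_ne h (hv j trivial)
    · intro v
      rw [← Finset.univ_sum_single v]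
      refine sum_mem fun j _ => ?_
      have := Submodule.mem_map_of_mem (f := LinearMap.single k (fun j => (M j).carrier) j)
        ((M j).mem_iSup_deg (v j))
      rw [Submodule.map_iSup] at this
      refine SetLike.le_def.1 (iSup_mono ?_) this
      rintro n _ ⟨e, he, rfl⟩ i -
      change Pi.single (M := fun j => (M j).carrier) j e i ∈ _
      by_cases h : i = j
      · subst h
        simpa using he
      · simp [h]
  op_smul_mem hv ha := fun j _ => (M j).op_smul_mem (hv j trivial) ha
  finite :=
    have := fun j => (M j).finite
    inferInstance

section Pi

variable {J : Type} [Fintype J] [DecidableEq J] (M : J → GrMod 𝒜)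

/-- The inclusion of a summand. -/
noncomputable def inj (j : J) : M j ⟶ pi M :=
  mkHom (N := pi M) (LinearMap.single Rᵐᵒᵖ (fun j => (M j).carrier) j) fun n e he i _ => by
    change Pi.single (M := fun j => (M j).carrier) j e i ∈ _
    by_cases h : i = j
    · subst h
      simpa using he
    · simp [h]

/-- The projection to a summand. -/
noncomputable def prj (j : J) : pi M ⟶ M j :=
  mkHom (M := pi M) (LinearMap.proj j) fun _ _ hv => hv j trivial

theorem inj_prj_same (j : J) : inj M j ≫ prj M j = 𝟙 _ :=
  hom_ext fun v => Pi.single_eq_same (M := fun j => (M j).carrier) j v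

theorem inj_prj_ne {i j : J} (h : i ≠ j) : inj M i ≫ prj M j = 0 :=
  hom_ext fun v => Pi.single_eq_of_ne (M := fun j => (M j).carrier) h.symm v

theorem sum_prj_inj : ∑ j, prj M j ≫ inj M j = 𝟙 (pi M) := by
  refine hom_ext fun v => ?_
  rw [lin_sum, LinearMap.sum_apply]
  exact Finset.univ_sum_single (M := fun j => (M j).carrier) v

variable {M}

/-- The morphism from a direct sum given by morphisms from the summands. -/
noncomputable def desc {N : GrMod 𝒜} (f : ∀ j : J, M j ⟶ N) : pi M ⟶ N :=
  ∑ j, prj M j ≫ f j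

theorem inj_desc {N : GrMod 𝒜} (f : ∀ j : J, M j ⟶ N) (j : J) : inj M j ≫ desc f = f j := by
  rw [desc, Preadditive.comp_sum, Finset.sum_eq_single j]
  · rw [← Category.assoc, inj_prj_same, Category.id_comp]
  · intro i _ h
    rw [← Category.assoc, inj_prj_ne M h.symm, Limits.zero_comp]
  · simp

theorem range_desc {N : GrMod 𝒜} (f : ∀ j : J, M j ⟶ N) :
    LinearMap.range (lin (desc f)) = ⨆ j, LinearMap.range (lin (f j)) := by
  refine le_antisymm ?_ (iSup_le fun j => ?_)
  · rintro _ ⟨v, rfl⟩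
    rw [desc, lin_sum, LinearMap.sum_apply]
    exact sum_mem fun j _ => Submodule.mem_iSup_of_mem j ⟨_, rfl⟩
  · rw [← inj_desc f j, lin_comp]
    exact LinearMap.range_comp_le_range _ _

theorem desc_ext {N : GrMod 𝒜} {f g : pi M ⟶ N} (h : ∀ j, inj M j ≫ f = inj M j ≫ g) : f = g := by
  rw [← Category.id_comp f, ← Category.id_comp g, ← sum_prj_inj, Preadditive.sum_comp,
    Preadditive.sum_comp]
  simp [h]

instance projective_pi [∀ j, Projective (M j)] : Projective (pi M) := by
  refine ⟨fun {E X} f e _ => ⟨desc fun j => Projective.factorThru (inj M j ≫ f) e, ?_⟩⟩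
  refine desc_ext fun j => ?_
  rw [← Category.assoc, inj_desc, Projective.factorThru_comp]

end Pi

end Graded

end GrMod

namespace GrMod

section Quotient

variable {k : Type u} [Field k] {R : Type u} [Ring R] [Algebra k R] {𝒜 : ℤ → Submodule k R}

/-! ### Finite-dimensional modules and the quotient category -/

/-- Finite-dimensionality over the ground field. -/
abbrev FinDim (M : GrMod 𝒜) : Prop := Module.Finite k M.carrier

theorem FinDim.of_surjective {M N : GrMod 𝒜} (f : M ⟶ N) (h : Function.Surjective (lin f))
    (hM : M.FinDim) : N.FinDim := Module.Finite.of_surjective (klin f) h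

theorem finite_of_le {V : Type*} [AddCommGroup V] [Module k V] {S T : Submodule k V} (h : S ≤ T)
    [Module.Finite k T] : Module.Finite k S :=
  Module.Finite.of_injective _ (Submodule.inclusion_injective h)

theorem finite_of_exact {A B C : Type*} [AddCommGroup A] [Module k A] [AddCommGroup B] [Module k B]
    [AddCommGroup C] [Module k C] (f : A →ₗ[k] B) (g : B →ₗ[k] C)
    (h : LinearMap.ker g ≤ LinearMap.range f) [Module.Finite k A] [Module.Finite k C] :
    Module.Finite k B := by
  have h₁ : Module.Finite k (LinearMap.ker g) := finite_of_le h
  have h₂ : (LinearMap.ker g).FG := Module.Finite.iff_fg.1 h₁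
  exact Module.finite_def.2 (Submodule.fg_of_fg_map_of_fg_inf_ker g
    (IsNoetherian.noetherian _) (by rwa [top_inf_eq]))

theorem isoModFDim_iff {M N : GrMod 𝒜} (f : M ⟶ N) :
    isoModFDim 𝒜 f ↔ Module.Finite k (LinearMap.ker (klin f)) ∧ (coker f).FinDim := Iff.rfl

/-- The sequence coker f → coker (f ≫ g) → coker g is exact in the middle. -/
theorem finDim_coker_comp {M N L : GrMod 𝒜} (f : M ⟶ N) (g : N ⟶ L) (hf : (coker f).FinDim)
    (hg : (coker g).FinDim) : (coker (f ≫ g)).FinDim := by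
  let a : coker f ⟶ coker (f ≫ g) := quotLift _ _ (g ≫ cokerπ (f ≫ g)) (by
    rintro _ ⟨v, rfl⟩
    exact LinearMap.congr_fun (congrArg lin (comp_cokerπ (f ≫ g))) v)
  let b : coker (f ≫ g) ⟶ coker g := quotLift _ _ (cokerπ g) (by
    rintro _ ⟨v, rfl⟩
    exact lin_quotMk_eq_zero.2 ⟨lin f v, rfl⟩)
  refine finite_of_exact (klin a) (klin b) fun v hv => ?_
  obtain ⟨v, rfl⟩ := lin_quotMk_surjective _ _ _ v
  obtain ⟨w, rfl⟩ : v ∈ LinearMap.range (lin g) := lin_quotMk_eq_zero.1 hv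
  exact ⟨lin (cokerπ f) w, rfl⟩

/-- The sequence ker f → ker (f ≫ g) → ker g is exact in the middle. -/
theorem finite_ker_comp {M N L : GrMod 𝒜} (f : M ⟶ N) (g : N ⟶ L)
    (hf : Module.Finite k (LinearMap.ker (klin f)))
    (hg : Module.Finite k (LinearMap.ker (klin g))) :
    Module.Finite k (LinearMap.ker (klin (f ≫ g))) := by
  refine finite_of_exact
    (A := LinearMap.ker (klin f)) (C := LinearMap.ker (klin g))
    ((LinearMap.ker (klin f)).subtype.codRestrict _ fun v => ?_)
    ((klin f).restrict fun v hv => hv) fun v hv => ?_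
  · change lin g (lin f v) = 0
    rw [show lin f v = 0 from v.2, map_zero]
  · exact ⟨⟨v, congrArg Subtype.val hv⟩, rfl⟩

instance : (isoModFDim 𝒜).IsMultiplicative where
  id_mem M := by
    refine (isoModFDim_iff _).2 ⟨?_, ?_⟩
    · rw [LinearMap.ker_eq_bot_of_injective (f := klin (𝟙 M)) Function.injective_id]
      infer_instance
    · have : Subsingleton (coker (𝟙 M)).carrier := by
        refine subsingleton_of_forall_eq 0 fun v => ?_
        obtain ⟨v, rfl⟩ := lin_quotMk_surjective _ _ _ v
        exact lin_quotMk_eq_zero.2 ⟨v, rfl⟩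
      infer_instance
  comp_mem f g hf hg :=
    (isoModFDim_iff _).2 ⟨finite_ker_comp f g hf.1 hg.1, finDim_coker_comp f g hf.2 hg.2⟩

/-- The projection to a quotient by a finite-dimensional submodule is inverted in the quotient
category. -/
theorem isoModFDim_quotMk {M : GrMod 𝒜} {N : Submodule Rᵐᵒᵖ M.carrier} (hN : M.IsHomog N)
    (h : Module.Finite k (N.restrictScalars k)) : isoModFDim 𝒜 (M.quotMk N hN) := by
  refine (isoModFDim_iff _).2 ⟨?_, ?_⟩
  · have : LinearMap.ker (klin (M.quotMk N hN)) = N.restrictScalars k :=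
      Submodule.ext fun v => lin_quotMk_eq_zero
    rwa [this]
  · have : Subsingleton (coker (M.quotMk N hN)).carrier := by
      refine subsingleton_of_forall_eq 0 fun v => ?_
      obtain ⟨v, rfl⟩ := lin_quotMk_surjective _ _ _ v
      exact lin_quotMk_eq_zero.2 (lin_quotMk_surjective _ _ _ v)
    infer_instance

/-- The map f factors through the cokernel of s, so its image is a quotient of a finite-dimensional
space. -/
theorem finite_range_of_finDim_coker {M N L : GrMod 𝒜} (s : M ⟶ N) (hs : (coker s).FinDim)
    (f : N ⟶ L) (hf : s ≫ f = 0) :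
    Module.Finite k ((LinearMap.range (lin f)).restrictScalars k) := by
  let g : coker s ⟶ L := quotLift _ _ f (by
    rintro _ ⟨v, rfl⟩
    exact LinearMap.congr_fun (congrArg lin hf) v)
  refine finite_of_le (T := LinearMap.range (klin g)) ?_
  rintro _ ⟨v, rfl⟩
  exact ⟨lin (cokerπ s) v, rfl⟩

/-- The Ore condition is solved by the pushout, realised as the cokernel of d = (s, -f) : X' → X ⊕
Y. The kernel of Y → pushout lies in f (ker s), and its cokernel is a quotient of coker s. For
cancellation, if s ≫ (f₁ - f₂) = 0 then f₁ - f₂ has finite-dimensional image, and dividing that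
image out equalizes f₁ and f₂. -/
instance : (isoModFDim 𝒜).HasLeftCalculusOfFractions where
  exists_leftFraction X Y φ := by
    obtain ⟨s, hs, f⟩ := φ
    rename_i X'
    let F : Bool → GrMod 𝒜 := fun b => cond b X Y
    let i₁ : X ⟶ pi F := inj F true
    let i₂ : Y ⟶ pi F := inj F false
    let p₁ : pi F ⟶ X := prj F true
    let p₂ : pi F ⟶ Y := prj F false
    have h₁₁ : i₁ ≫ p₁ = 𝟙 X := inj_prj_same F true
    have h₂₂ : i₂ ≫ p₂ = 𝟙 Y := inj_prj_same F false
    have h₁₂ : i₁ ≫ p₂ = 0 := inj_prj_ne F (by simp)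
    have h₂₁ : i₂ ≫ p₁ = 0 := inj_prj_ne F (by simp)
    have htot : p₁ ≫ i₁ + p₂ ≫ i₂ = 𝟙 (pi F) := by
      rw [← sum_prj_inj, Fintype.sum_bool]
    let d : X' ⟶ pi F := s ≫ i₁ - f ≫ i₂
    have hd : f ≫ i₂ ≫ cokerπ d = s ≫ i₁ ≫ cokerπ d := by
      have := comp_cokerπ d
      simp only [d, Preadditive.sub_comp, Category.assoc] at this
      exact (sub_eq_zero.1 this).symm
    refine ⟨⟨i₁ ≫ cokerπ d, i₂ ≫ cokerπ d, (isoModFDim_iff _).2 ⟨?_, ?_⟩⟩, hd⟩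
    · have h₁ : Module.Finite k (LinearMap.ker (klin s)) := hs.1
      refine finite_of_le (T := (LinearMap.ker (klin s)).map (klin f)) fun y hy => ?_
      obtain ⟨x, hx⟩ : lin i₂ y ∈ LinearMap.range (lin d) := lin_quotMk_eq_zero.1 hy
      have hd₁ : d ≫ p₁ = s := by simp [d, h₁₁, h₂₁]
      have hd₂ : d ≫ p₂ = -f := by simp [d, h₁₂, h₂₂]
      refine ⟨-x, ?_, ?_⟩
      · have h₃ : lin s x = lin (i₂ ≫ p₁) y := by
          rw [← hd₁]
          exact congrArg (lin p₁) hx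
        rw [h₂₁] at h₃
        exact (LinearMap.ker (klin s)).neg_mem h₃
      · have h₃ : lin (-f) x = lin (i₂ ≫ p₂) y := by
          rw [← hd₂]
          exact congrArg (lin p₂) hx
        rw [h₂₂] at h₃
        exact (map_neg (lin f) x).trans h₃
    · let q := cokerπ (i₂ ≫ cokerπ d)
      have hq : i₂ ≫ cokerπ d ≫ q = 0 := by rw [← Category.assoc]; exact comp_cokerπ _
      have hsq : s ≫ i₁ ≫ cokerπ d ≫ q = 0 := by
        have := congrArg (· ≫ q) hd
        simp only [Category.assoc, hq, Limits.comp_zero] at this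
        exact this.symm
      refine FinDim.of_surjective (M := coker s) (quotLift _ _ (i₁ ≫ cokerπ d ≫ q) ?_) ?_ hs.2
      · rintro _ ⟨v, rfl⟩
        exact LinearMap.congr_fun (congrArg lin hsq) v
      · intro v
        obtain ⟨v, rfl⟩ := lin_quotMk_surjective _ _ _ v
        obtain ⟨v, rfl⟩ := lin_quotMk_surjective _ _ _ v
        refine ⟨lin (cokerπ s) (lin p₁ v), ?_⟩
        have h₃ : p₁ ≫ i₁ ≫ cokerπ d ≫ q = cokerπ d ≫ q := by
          have := congrArg (· ≫ cokerπ d ≫ q) htot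
          simpa only [Preadditive.add_comp, Category.assoc, hq, Limits.comp_zero, add_zero,
            Category.id_comp] using this
        exact LinearMap.congr_fun (congrArg lin h₃) v
  ext X' X Y f₁ f₂ s hs h := by
    have hs' : s ≫ (f₁ - f₂) = 0 := by rw [Preadditive.comp_sub, h, sub_self]
    refine ⟨_, cokerπ (f₁ - f₂), isoModFDim_quotMk _
      (finite_range_of_finDim_coker s hs.2 _ hs'), ?_⟩
    rw [← sub_eq_zero, ← Preadditive.sub_comp, comp_cokerπ]

/-! ### Epimorphisms and coproducts in the quotient category -/

/-- By the calculus of fractions, equality after `qgrπ` means equality after some denominator t.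
Then the image of f - g lies in the finite-dimensional kernel of t; conversely the projection modulo
that image serves as t. -/
theorem qgrπ_map_eq_iff {M N : GrMod 𝒜} (f g : M ⟶ N) :
    (qgrπ 𝒜).map f = (qgrπ 𝒜).map g ↔
      Module.Finite k ((LinearMap.range (lin (f - g))).restrictScalars k) := by
  rw [MorphismProperty.map_eq_iff_postcomp (qgrπ 𝒜) (isoModFDim 𝒜)]
  constructor
  · rintro ⟨Z, t, ht, h⟩
    have h₁ : Module.Finite k (LinearMap.ker (klin t)) := ht.1
    refine finite_of_le (T := LinearMap.ker (klin t)) ?_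
    rintro _ ⟨v, rfl⟩
    have : (f - g) ≫ t = 0 := by rw [Preadditive.sub_comp, h, sub_self]
    exact LinearMap.congr_fun (congrArg lin this) v
  · intro h
    refine ⟨_, cokerπ (f - g), isoModFDim_quotMk _ h, ?_⟩
    rw [← sub_eq_zero, ← Preadditive.sub_comp, comp_cokerπ]

theorem qgrπ_obj_surjective (Z : Qgr 𝒜) : ∃ M, (qgrπ 𝒜).obj M = Z :=
  (Localization.Construction.objEquiv (isoModFDim 𝒜)).surjective Z

/-- Two test morphisms are written with a common denominator, which reduces to numerators φ.f and
φ.f'. If they agree after f, then f ≫ (φ.f - φ.f') has finite-dimensional image; modulo that image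
φ.f - φ.f' factors through coker f, so it too has finite-dimensional image. -/
theorem epi_qgrπ_map_of_finDim_coker {M N : GrMod 𝒜} (f : M ⟶ N) (hf : (coker f).FinDim) :
    Epi ((qgrπ 𝒜).map f) := by
  refine ⟨fun {Z} a b hab => ?_⟩
  obtain ⟨Z, rfl⟩ := qgrπ_obj_surjective Z
  obtain ⟨φ, rfl, rfl⟩ := Localization.exists_leftFraction₂ (qgrπ 𝒜) (isoModFDim 𝒜) a b
  have hL := Localization.inverts (qgrπ 𝒜) (isoModFDim 𝒜)
  have h₁ := congrArg (· ≫ (qgrπ 𝒜).map φ.s) hab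
  have hfst : φ.fst.map (qgrπ 𝒜) hL ≫ (qgrπ 𝒜).map φ.s = (qgrπ 𝒜).map φ.f :=
    φ.fst.map_comp_map_s _ _
  have hsnd : φ.snd.map (qgrπ 𝒜) hL ≫ (qgrπ 𝒜).map φ.s = (qgrπ 𝒜).map φ.f' :=
    φ.snd.map_comp_map_s _ _
  simp only [Category.assoc, hfst, hsnd] at h₁
  have h₂ : (qgrπ 𝒜).map φ.f = (qgrπ 𝒜).map φ.f' := by
    rw [← Functor.map_comp, ← Functor.map_comp, qgrπ_map_eq_iff, ← Preadditive.comp_sub] at h₁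
    have := hL (cokerπ (f ≫ (φ.f - φ.f'))) (isoModFDim_quotMk _ h₁)
    rw [← cancel_mono ((qgrπ 𝒜).map (cokerπ (f ≫ (φ.f - φ.f')))), ← Functor.map_comp,
      ← Functor.map_comp,
      qgrπ_map_eq_iff, ← Preadditive.sub_comp]
    refine finite_range_of_finDim_coker f hf _ ?_
    rw [← Category.assoc]
    exact comp_cokerπ _
  rw [← cancel_mono ((qgrπ 𝒜).map φ.s), hfst, hsnd, h₂]

/-- The projection to coker f becomes zero in the quotient category, so its image, all of coker f,
is finite-dimensional. -/
theorem finDim_coker_of_epi {M N : GrMod 𝒜} (f : M ⟶ N) [Epi ((qgrπ 𝒜).map f)] :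
    (coker f).FinDim := by
  have h : (qgrπ 𝒜).map (cokerπ f) = (qgrπ 𝒜).map 0 := by
    rw [← cancel_epi ((qgrπ 𝒜).map f), ← Functor.map_comp, ← Functor.map_comp, comp_cokerπ,
      Limits.comp_zero]
  rw [qgrπ_map_eq_iff, sub_zero] at h
  refine Module.Finite.of_surjective ((LinearMap.range (lin (cokerπ f))).restrictScalars k).subtype
    fun v => ⟨⟨v, lin_quotMk_surjective _ _ _ v⟩, rfl⟩

/-- The quotient functor maps finite direct sums to coproducts. -/
noncomputable def isColimitQgrπPi {J : Type} [Fintype J] [DecidableEq J] (M : J → GrMod 𝒜) :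
    Limits.IsColimit (Limits.Cofan.mk ((qgrπ 𝒜).obj (pi M)) fun j => (qgrπ 𝒜).map (inj M j)) :=
  Limits.Cofan.IsColimit.mk _ (fun s => ∑ j, (qgrπ 𝒜).map (prj M j) ≫ s.inj j)
    (fun s j => by
      rw [Limits.cofan_mk_inj, Preadditive.comp_sum, Finset.sum_eq_single j]
      · rw [← Category.assoc, ← Functor.map_comp, inj_prj_same, CategoryTheory.Functor.map_id,
          Category.id_comp]
      · intro i _ h
        rw [← Category.assoc, ← Functor.map_comp, inj_prj_ne M h.symm, Functor.map_zero,
          Limits.zero_comp]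
      · simp)
    (fun s m hm => by
      rw [← Category.id_comp m]
      change 𝟙 ((qgrπ 𝒜).obj (pi M)) ≫ m = _
      rw [← CategoryTheory.Functor.map_id, ← sum_prj_inj, Functor.map_sum, Preadditive.sum_comp]
      refine Finset.sum_congr rfl fun j _ => ?_
      rw [← hm j, Functor.map_comp, Category.assoc]
      rfl)

/-- If `D` is projective without nonzero maps to finite-dimensional modules, then it remains
projective in the quotient category. -/
theorem projective_qgrπ_obj {D : GrMod 𝒜} [Projective D]
    (hD : ∀ V : GrMod 𝒜, V.FinDim → ∀ f : D ⟶ V, f = 0) : Projective ((qgrπ 𝒜).obj D) := by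
  -- The composite of g with the projection to the finite-dimensional coker s is zero, so g lands in
  -- the image of s and projectivity lifts it.
  have lift : ∀ {M N : GrMod 𝒜} (s : M ⟶ N) (_ : (coker s).FinDim) (g : D ⟶ N),
      ∃ g', g' ≫ s = g := fun s hs g => exists_lift s g fun v => lin_quotMk_eq_zero.1
    (LinearMap.congr_fun (congrArg lin (hD _ hs (g ≫ cokerπ s))) v)
  refine ⟨fun {M N} g e _ => ?_⟩
  obtain ⟨M, rfl⟩ := qgrπ_obj_surjective M
  obtain ⟨N, rfl⟩ := qgrπ_obj_surjective N
  obtain ⟨φ, rfl⟩ := Localization.exists_leftFraction (qgrπ 𝒜) (isoModFDim 𝒜) e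
  obtain ⟨ψ, hψ⟩ := Localization.exists_leftFraction (qgrπ 𝒜) (isoModFDim 𝒜)
    (g ≫ (qgrπ 𝒜).map φ.s)
  -- Lifting the numerator along the denominator turns the fraction g ≫ φ.s into the image of an
  -- honest morphism of graded modules.
  obtain ⟨g₁, hg₁⟩ := lift ψ.s ψ.hs.2 ψ.f
  have hg : (qgrπ 𝒜).map g₁ = g ≫ (qgrπ 𝒜).map φ.s := by
    rw [hψ, ← cancel_mono ((qgrπ 𝒜).map ψ.s), MorphismProperty.LeftFraction.map_comp_map_s,
      ← Functor.map_comp, hg₁]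
  have : Epi ((qgrπ 𝒜).map φ.f) := by
    rw [← MorphismProperty.LeftFraction.map_comp_map_s φ (qgrπ 𝒜)
      (Localization.inverts (qgrπ 𝒜) (isoModFDim 𝒜))]
    exact epi_comp _ _
  obtain ⟨g₂, hg₂⟩ := lift φ.f (finDim_coker_of_epi φ.f) g₁
  refine ⟨(qgrπ 𝒜).map g₂, ?_⟩
  rw [← cancel_mono ((qgrπ 𝒜).map φ.s), Category.assoc]
  rw [MorphismProperty.LeftFraction.map_comp_map_s]
  rw [← Functor.map_comp, hg₂, hg]

end Quotient
end GrMod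

namespace GrMod

/-! ### Free modules and homogeneous generators -/

section Free

variable {k : Type u} [Field k] {R : Type u} [Ring R] [Algebra k R] (𝒜 : ℤ → Submodule k R)
  [GradedAlgebra 𝒜]

/-- The graded right module `R`. -/
def self : GrMod 𝒜 where
  carrier := R
  deg := 𝒜
  isInternal := DirectSum.Decomposition.isInternal 𝒜
  op_smul_mem := fun hm ha => SetLike.mul_mem_graded hm ha
  finite := ⟨⟨{1}, eq_top_iff.2 fun a _ => by
    rw [Finset.coe_singleton, Submodule.mem_span_singleton]
    exact ⟨MulOpposite.op a, by simp⟩⟩⟩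

variable {𝒜}

theorem op_smul_mem_of_mem {𝒜 : ℤ → Submodule k R} {M : GrMod 𝒜} {n : ℤ} {e : M.carrier}
    (he : e ∈ M.deg n) {i : ℤ} {a : R} (ha : a ∈ 𝒜 (i - n)) : MulOpposite.op a • e ∈ M.deg i := by
  have := M.op_smul_mem he ha
  rwa [add_sub_cancel] at this

/-- The morphism `R⟨n⟩ ⟶ M` given by an element of degree `n`. -/
def ofElem {M : GrMod 𝒜} {n : ℤ} (e : M.carrier) (he : e ∈ M.deg n) :
    (self 𝒜).shift n ⟶ M :=
  mkHom (M := (self 𝒜).shift n)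
    { toFun := fun a : R => MulOpposite.op a • e
      map_add' := fun a b => add_smul (@MulOpposite.op R a) (@MulOpposite.op R b) e
      map_smul' := fun b (a : R) => by
        rw [RingHom.id_apply, smul_smul]
        rfl }
    fun i a ha => op_smul_mem_of_mem he ha

/-- The generator of `R⟨n⟩`. -/
def free1 (𝒜 : ℤ → Submodule k R) [GradedAlgebra 𝒜] (n : ℤ) : ((self 𝒜).shift n).carrier := (1 : R)

/-- The element of `R` underlying an element of `R⟨n⟩`. -/
def coord {n : ℤ} : ((self 𝒜).shift n).carrier →ₗ[Rᵐᵒᵖ] R := LinearMap.id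

theorem free1_mem (n : ℤ) : free1 𝒜 n ∈ ((self 𝒜).shift n).deg n := by
  change (1 : R) ∈ 𝒜 (n - n)
  rw [sub_self]
  exact SetLike.GradedOne.one_mem

theorem coord_free1 (n : ℤ) : coord (free1 𝒜 n) = 1 := rfl

theorem op_coord_smul_free1 {n : ℤ} (v : ((self 𝒜).shift n).carrier) :
    MulOpposite.op (coord v) • free1 𝒜 n = v := @one_mul R _ v

theorem coord_mem {n i : ℤ} {v : ((self 𝒜).shift n).carrier} (hv : v ∈ ((self 𝒜).shift n).deg i) :
    coord v ∈ 𝒜 (i - n) := hv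

theorem lin_ofElem_free1 {M : GrMod 𝒜} {n : ℤ} (e : M.carrier) (he : e ∈ M.deg n) :
    lin (ofElem e he) (free1 𝒜 n) = e := one_smul _ e

theorem free_hom_ext {M : GrMod 𝒜} {n : ℤ} {f g : (self 𝒜).shift n ⟶ M}
    (h : lin f (free1 𝒜 n) = lin g (free1 𝒜 n)) : f = g :=
  hom_ext fun v => by rw [← op_coord_smul_free1 v, map_smul, map_smul, h]

/-- Finitely many homogeneous generators. -/
theorem exists_generators {𝒜 : ℤ → Submodule k R} (M : GrMod 𝒜) :
    ∃ (r : ℕ) (d : Fin r → ℤ) (s : Fin r → M.carrier), (∀ i, s i ∈ M.deg (d i)) ∧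
      Submodule.span Rᵐᵒᵖ (Set.range s) = ⊤ := by
  obtain ⟨t, ht⟩ := M.finite.fg_top
  choose F hF using fun v : M.carrier => exists_finset_sum_proj v
  let J := Σ v : t, F v
  let e := (Fintype.equivFin J).symm
  refine ⟨Fintype.card J, fun i => (e i).2, fun i => M.proj (e i).2 (e i).1,
    fun i => M.proj_mem _ _, ?_⟩
  rw [eq_top_iff, ← ht, Submodule.span_le]
  intro v hv
  rw [← hF v]
  refine sum_mem fun n hn => Submodule.subset_span ⟨e.symm ⟨⟨v, hv⟩, ⟨n, hn⟩⟩, ?_⟩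
  have : e (e.symm ⟨⟨v, hv⟩, ⟨n, hn⟩⟩) = ⟨⟨v, hv⟩, ⟨n, hn⟩⟩ := e.apply_symm_apply _
  dsimp only
  rw [this]

end Free

end GrMod

namespace GWA

open Polynomial GrMod MulOpposite

variable {k : Type u} [Field k]

/-! ### Relations and normal forms -/

section Algebra

variable (f : k[X])

local notation "𝐱" => gen f Gen.x
local notation "𝐲" => gen f Gen.y
local notation "𝐳" => gen f Gen.z

theorem x_mul_z : 𝐱 * 𝐳 = (𝐳 + 1) * 𝐱 := by
  simpa [gen] using RingQuot.mkAlgHom_rel k (Rel.xz (f := f))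

theorem y_mul_z : 𝐲 * 𝐳 = (𝐳 - 1) * 𝐲 := by
  simpa [gen] using RingQuot.mkAlgHom_rel k (Rel.yz (f := f))

theorem x_mul_y : 𝐱 * 𝐲 = aeval 𝐳 f := by
  have := RingQuot.mkAlgHom_rel k (Rel.xy (f := f))
  rwa [map_mul, ← aeval_algHom_apply] at this

theorem y_mul_x : 𝐲 * 𝐱 = aeval 𝐳 (f.comp (X - 1)) := by
  have := RingQuot.mkAlgHom_rel k (Rel.yx (f := f))
  rwa [map_mul, ← aeval_algHom_apply] at this

theorem mul_aeval_z_of {a b : GWA f} (h : a * 𝐳 = b * a) (p : k[X]) :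
    a * aeval 𝐳 p = aeval b p * a := by
  induction p using Polynomial.induction_on' with
  | add p q hp hq => rw [map_add, map_add, mul_add, add_mul, hp, hq]
  | monomial n c =>
    rw [aeval_monomial, aeval_monomial, ← mul_assoc, ← Algebra.commutes, mul_assoc, mul_assoc,
      (SemiconjBy.pow_right (show SemiconjBy a 𝐳 b from h) n).eq]

theorem x_mul_aeval (p : k[X]) : 𝐱 * aeval 𝐳 p = aeval 𝐳 (p.comp (X + 1)) * 𝐱 := by
  rw [mul_aeval_z_of f (x_mul_z f), aeval_comp]
  simp

theorem y_mul_aeval (p : k[X]) : 𝐲 * aeval 𝐳 p = aeval 𝐳 (p.comp (X - 1)) * 𝐲 := by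
  rw [mul_aeval_z_of f (y_mul_z f), aeval_comp]
  simp

theorem induction {p : GWA f → Prop} (hx : p 𝐱) (hy : p 𝐲) (hz : p 𝐳)
    (hc : ∀ c, p (algebraMap k _ c)) (hadd : ∀ a b, p a → p b → p (a + b))
    (hmul : ∀ a b, p a → p b → p (a * b)) (a : GWA f) : p a := by
  obtain ⟨a, rfl⟩ := RingQuot.mkAlgHom_surjective k (Rel f) a
  induction a using FreeAlgebra.induction with
  | grade0 c => rw [AlgHom.commutes]; exact hc c
  | grade1 g => cases g <;> assumption
  | mul a b ha hb => rw [map_mul]; exact hmul _ _ ha hb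
  | add a b ha hb => rw [map_add]; exact hadd _ _ ha hb

/-- The monomial `x ^ d` if `d ≥ 0`, and `y ^ (-d)` if `d ≤ 0`. -/
def mono (d : ℤ) : GWA f := 𝐱 ^ d.toNat * 𝐲 ^ (-d).toNat

theorem mono_natCast (n : ℕ) : mono f n = 𝐱 ^ n := by simp [mono]

theorem mono_neg_natCast (n : ℕ) : mono f (-n) = 𝐲 ^ n := by simp [mono]

theorem mono_zero : mono f 0 = 1 := by simp [mono]

theorem mono_mem (d : ℤ) : mono f d ∈ grading f d := by
  have h₁ := SetLike.pow_mem_graded (A := grading f) d.toNat (gen_mem f Gen.x)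
  have h₂ := SetLike.pow_mem_graded (A := grading f) (-d).toNat (gen_mem f Gen.y)
  have := SetLike.mul_mem_graded h₁ h₂
  rwa [show d.toNat • Gen.wt .x + (-d).toNat • Gen.wt .y = d by simp [Gen.wt]; omega] at this

theorem aeval_mem (p : k[X]) : aeval 𝐳 p ∈ grading f 0 := by
  induction p using Polynomial.induction_on' with
  | add p q hp hq => rw [map_add]; exact add_mem hp hq
  | monomial n c =>
    rw [aeval_monomial, ← Algebra.smul_def]
    refine Submodule.smul_mem _ _ ?_
    simpa [Gen.wt] using SetLike.pow_mem_graded (A := grading f) n (gen_mem f Gen.z)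

theorem gen_mul_mono (g : Gen.{u}) (d : ℤ) :
    ∃ p : k[X], gen f g * mono f d = aeval 𝐳 p * mono f (g.wt + d) := by
  cases g with
  | z => exact ⟨X, by simp [Gen.wt]⟩
  | x =>
    obtain ⟨n, rfl | rfl⟩ := d.eq_nat_or_neg
    · refine ⟨1, ?_⟩
      rw [mono_natCast, Gen.wt, ← pow_succ', ← mono_natCast, map_one, one_mul]
      push_cast
      rw [add_comm]
    · cases n with
      | zero => exact ⟨1, by simp [mono, Gen.wt]⟩
      | succ n =>
        refine ⟨f, ?_⟩
        rw [mono_neg_natCast, pow_succ', ← mul_assoc, x_mul_y, Gen.wt, ← mono_neg_natCast]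
        push_cast
        rw [neg_add, add_comm (-(n : ℤ)), add_neg_cancel_left]
  | y =>
    obtain ⟨n, rfl | rfl⟩ := d.eq_nat_or_neg
    · cases n with
      | zero => exact ⟨1, by simp [mono, Gen.wt]⟩
      | succ n =>
        refine ⟨f.comp (X - 1), ?_⟩
        rw [mono_natCast, pow_succ', ← mul_assoc, y_mul_x, Gen.wt, ← mono_natCast]
        push_cast
        rw [add_comm (n : ℤ), neg_add_cancel_left]
    · refine ⟨1, ?_⟩
      rw [mono_neg_natCast, Gen.wt, ← pow_succ', ← mono_neg_natCast, map_one, one_mul]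
      push_cast
      rw [neg_add, add_comm]

/-- Polynomials in z move to the left past every generator, and each product xy or yx collapses to a
polynomial in z. So each component of A is cyclic over k[z]. -/
theorem exists_eq_aeval_mul_mono {d : ℤ} {a : GWA f} (ha : a ∈ grading f d) :
    ∃ p : k[X], a = aeval 𝐳 p * mono f d := by
  induction ha using Submodule.span_induction with
  | mem a h =>
    obtain ⟨l, rfl, rfl⟩ := h
    induction l with
    | nil => exact ⟨1, by simp [mono]⟩
    | cons g l ih =>
      obtain ⟨p, hp⟩ := ih
      have hg : ∃ q : k[X], gen f g * aeval 𝐳 p = aeval 𝐳 q * gen f g := by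
        cases g with
        | x => exact ⟨_, x_mul_aeval f p⟩
        | y => exact ⟨_, y_mul_aeval f p⟩
        | z =>
          have := congrArg (aeval 𝐳) (mul_comm X p)
          exact ⟨p, by rwa [map_mul, map_mul, aeval_X] at this⟩
      obtain ⟨q, hq⟩ := hg
      obtain ⟨t, ht⟩ := gen_mul_mono f g (l.map Gen.wt).sum
      refine ⟨q * t, ?_⟩
      rw [List.map_cons, List.prod_cons, List.map_cons, List.sum_cons, hp, ← mul_assoc, hq,
        mul_assoc, ht, map_mul, mul_assoc]
  | zero => exact ⟨0, by simp⟩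
  | add a b _ _ ha hb =>
    obtain ⟨p, rfl⟩ := ha
    obtain ⟨q, rfl⟩ := hb
    exact ⟨p + q, by rw [map_add, add_mul]⟩
  | smul c a _ ha =>
    obtain ⟨p, rfl⟩ := ha
    exact ⟨c • p, by rw [map_smul, smul_mul_assoc]⟩

/-- The images of the generators under `rep`. -/
noncomputable def repGen : Gen.{u} → Module.End k k[X]
  | .x => (aeval (X + 1 : k[X])).toLinearMap
  | .y => Algebra.lmul k k[X] (f.comp (X - 1)) * (aeval (X - 1 : k[X])).toLinearMap
  | .z => Algebra.lmul k k[X] X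

theorem repGen_x (p : k[X]) : repGen f Gen.x p = p.comp (X + 1) := by
  simp [repGen, aeval_def, comp, algebraMap_eq]

theorem repGen_y (p : k[X]) : repGen f Gen.y p = f.comp (X - 1) * p.comp (X - 1) := by
  simp [repGen, aeval_def, comp, algebraMap_eq]

theorem aeval_repGen_z (p : k[X]) : aeval (repGen f Gen.z) p = Algebra.lmul k k[X] p := by
  rw [repGen, aeval_algHom_apply, aeval_X_left_apply]

/-- The action of `A(f)` on `k[z]` where `x` is the shift `p(z) ↦ p(z + 1)`. -/
noncomputable def rep : GWA f →ₐ[k] Module.End k k[X] :=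
  RingQuot.liftAlgHom k ⟨FreeAlgebra.lift k (repGen f), by
    intro a b h
    cases h <;> refine LinearMap.ext fun p => ?_ <;>
      simp only [map_mul, map_add, map_sub, map_one, FreeAlgebra.lift_ι_apply,
        ← aeval_algHom_apply, Module.End.mul_apply, repGen_x, repGen_y, aeval_repGen_z,
        LinearMap.add_apply, LinearMap.sub_apply, Module.End.one_apply]
    · simp [repGen, add_mul]
    · simp [repGen, sub_mul]; ring
    · simp [comp_assoc]
    · simp [comp_assoc]⟩

theorem rep_gen (g : Gen.{u}) : rep f (gen f g) = repGen f g := by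
  rw [rep, gen, RingQuot.liftAlgHom_mkAlgHom_apply, FreeAlgebra.lift_ι_apply]

theorem rep_aeval (p q : k[X]) : rep f (aeval 𝐳 p) q = p * q := by
  rw [← aeval_algHom_apply, rep_gen, aeval_repGen_z]
  rfl

/-- x acts as a translation and y as a translation followed by multiplication by f(z - 1) ≠ 0, both
injective on k[z]. -/
theorem rep_mono_ne_zero (hf : f ≠ 0) (d : ℤ) {p : k[X]} (hp : p ≠ 0) :
    rep f (mono f d) p ≠ 0 := by
  have hcomp : ∀ {q : k[X]} (c : k), q ≠ 0 → q.comp (X + C c) ≠ 0 := fun c hq h =>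
    hq (comp_X_add_C_eq_zero_iff.1 h)
  have hx (n : ℕ) : ∀ q : k[X], q ≠ 0 → rep f (𝐱 ^ n) q ≠ 0 := by
    induction n with
    | zero => exact fun q hq => by simpa using hq
    | succ n ih =>
      intro q hq
      rw [pow_succ, map_mul, Module.End.mul_apply, rep_gen, repGen_x]
      exact ih _ (by simpa using hcomp 1 hq)
  have hy (n : ℕ) : ∀ q : k[X], q ≠ 0 → rep f (𝐲 ^ n) q ≠ 0 := by
    induction n with
    | zero => exact fun q hq => by simpa using hq
    | succ n ih =>
      intro q hq
      rw [pow_succ, map_mul, Module.End.mul_apply, rep_gen, repGen_y]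
      refine ih _ (mul_ne_zero ?_ ?_)
      · simpa [sub_eq_add_neg] using hcomp (-1) hf
      · simpa [sub_eq_add_neg] using hcomp (-1) hq
  rw [mono, map_mul, Module.End.mul_apply]
  exact hx _ _ (hy _ _ hp)

/-- The representation `rep` separates the homogeneous elements. -/
theorem eq_zero_of_rep_one (hf : f ≠ 0) {d : ℤ} {a : GWA f} (ha : a ∈ grading f d)
    (h : rep f a 1 = 0) : a = 0 := by
  obtain ⟨p, rfl⟩ := exists_eq_aeval_mul_mono f ha
  rw [map_mul, Module.End.mul_apply, rep_aeval] at h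
  rw [(mul_eq_zero.1 h).resolve_right (rep_mono_ne_zero f hf d one_ne_zero), map_zero, zero_mul]

end Algebra

/-! ### The central operator `z - n` -/

section Operator

variable {f : k[X]}

local notation "𝐱" => gen f Gen.x
local notation "𝐲" => gen f Gen.y
local notation "𝐳" => gen f Gen.z

/-- Multiplication by the degree. -/
noncomputable def euler (M : GrMod (grading f)) : M.carrier →ₗ[k] M.carrier :=
  DirectSum.toModule k ℤ M.carrier (fun n => (n : k) • (M.deg n).subtype) ∘ₗ
    (DirectSum.decomposeLinearEquiv M.deg).toLinearMap

theorem euler_of_mem {M : GrMod (grading f)} {n : ℤ} {v : M.carrier} (hv : v ∈ M.deg n) :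
    euler M v = (n : k) • v := by
  rw [euler, LinearMap.comp_apply, LinearEquiv.coe_coe, DirectSum.decomposeLinearEquiv_apply,
    DirectSum.decompose_of_mem _ hv]
  exact DirectSum.toModule_lof k n _

theorem op_smul_smul {M : GrMod (grading f)} (a : GWA f) (c : k) (v : M.carrier) :
    op a • c • v = c • op a • v := by
  rw [← algebraMap_smul (GWA f)ᵐᵒᵖ c v, ← algebraMap_smul (GWA f)ᵐᵒᵖ c (op a • v), smul_smul,
    smul_smul, Algebra.commutes]

theorem op_mul_smul {M : GrMod (grading f)} (a b : GWA f) (v : M.carrier) :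
    op (a * b) • v = op b • op a • v := by
  rw [op_mul, mul_smul]

theorem op_algebraMap_smul {M : GrMod (grading f)} (c : k) (v : M.carrier) :
    op (algebraMap k (GWA f) c) • v = c • v := algebraMap_smul (GWA f)ᵐᵒᵖ c v

/-- The operator acting as `z - n` on the component of degree `n`. -/
noncomputable def wOp (M : GrMod (grading f)) : Module.End (GWA f)ᵐᵒᵖ M.carrier where
  toFun v := op 𝐳 • v - euler M v
  map_add' v w := by rw [smul_add, map_add, add_sub_add_comm]
  map_smul' a v := by
    obtain ⟨a, rfl⟩ := op_surjective a
    rw [RingHom.id_apply]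
    induction a using GWA.induction generalizing v with
    | hx =>
      induction v using GrMod.induction_on with
      | hom n v hv =>
        -- Right multiplication by x raises the degree by one, and xz = (z+1)x shifts z by one: the
        -- two shifts cancel in z - n. For y both shifts are by -1.
        rw [euler_of_mem hv, euler_of_mem (M.op_smul_mem hv (gen_mem f Gen.x)), ← op_mul_smul,
          x_mul_z, smul_sub, op_mul_smul, MulOpposite.op_add, add_smul, smul_add, op_smul_smul]
        simp [Gen.wt, add_smul]
      | add v w hv hw => 
        simp only [smul_add, map_add, smul_sub] at hv hw ⊢
        rw [add_sub_add_comm, hv, hw, add_sub_add_comm]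
    | hy =>
      induction v using GrMod.induction_on with
      | hom n v hv =>
        rw [euler_of_mem hv, euler_of_mem (M.op_smul_mem hv (gen_mem f Gen.y)), ← op_mul_smul,
          y_mul_z, smul_sub, op_mul_smul, MulOpposite.op_sub, sub_smul, smul_sub, op_smul_smul]
        simp only [Gen.wt, op_one, one_smul, Int.cast_add, Int.cast_neg, Int.cast_one, add_smul,
          neg_smul]
        abel
      | add v w hv hw =>
        simp only [smul_add, map_add, smul_sub] at hv hw ⊢
        rw [add_sub_add_comm, hv, hw, add_sub_add_comm]
    | hz =>
      induction v using GrMod.induction_on with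
      | hom n v hv =>
        rw [euler_of_mem hv, euler_of_mem (M.op_smul_mem hv (gen_mem f Gen.z)), smul_sub,
          op_smul_smul]
        simp [Gen.wt]
      | add v w hv hw =>
        simp only [smul_add, map_add, smul_sub] at hv hw ⊢
        rw [add_sub_add_comm, hv, hw, add_sub_add_comm]
    | hc c => rw [op_algebraMap_smul, op_algebraMap_smul, op_smul_smul, map_smul, smul_sub]
    | hadd a b ha hb =>
      rw [MulOpposite.op_add, add_smul, add_smul, ← ha, ← hb, smul_add, map_add, add_sub_add_comm]
    | hmul a b ha hb => rw [op_mul_smul, op_mul_smul, hb, ha]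

theorem wOp_of_mem {M : GrMod (grading f)} {n : ℤ} {v : M.carrier} (hv : v ∈ M.deg n) :
    wOp M v = op 𝐳 • v - (n : k) • v := by
  rw [← euler_of_mem hv]
  rfl

/-- The action of polynomials in the operator `wOp`. -/
noncomputable def wPoly (M : GrMod (grading f)) : k[X] →ₐ[k] Module.End (GWA f)ᵐᵒᵖ M.carrier :=
  aeval (wOp M)

theorem wPoly_mul (M : GrMod (grading f)) (p q : k[X]) (v : M.carrier) :
    wPoly M (p * q) v = wPoly M p (wPoly M q v) := by
  rw [map_mul]
  rfl

/-- On degree n the element z acts as w + n. This trades the noncentral z for the A-linear operator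
w. -/
theorem op_aeval_smul {M : GrMod (grading f)} {n : ℤ} {v : M.carrier} (hv : v ∈ M.deg n)
    (p : k[X]) : op (aeval 𝐳 p) • v = wPoly M (p.comp (X + C (n : k))) v := by
  have hz : op 𝐳 • v = wPoly M (X + C (n : k)) v := by
    simp [wPoly, wOp_of_mem hv, ← Int.cast_smul_eq_zsmul k]
  induction p using Polynomial.induction_on with
  | C c => simp [wPoly, op_algebraMap_smul, Module.algebraMap_end_apply]
  | add p q hp hq =>
    rw [map_add, MulOpposite.op_add, add_smul, hp, hq, add_comp, map_add, LinearMap.add_apply]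
  | monomial n c h =>
    rw [pow_succ', mul_left_comm, map_mul, op_mul_smul, aeval_X, hz, ← map_smul, h, ← wPoly_mul]
    simp

theorem wPoly_mem {M : GrMod (grading f)} {n : ℤ} {v : M.carrier} (hv : v ∈ M.deg n)
    (p : k[X]) : wPoly M p v ∈ M.deg n := by
  have h := op_aeval_smul hv (p.comp (X - C (n : k)))
  rw [comp_assoc] at h
  simp only [sub_comp, X_comp, C_comp, add_sub_cancel_right, comp_X] at h
  rw [← h]
  simpa using M.op_smul_mem hv (aeval_mem f _)

end Operator

end GWA

namespace GWA

open Polynomial GrMod MulOpposite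

variable {k : Type u} [Field k]

/-! ### Finiteness over k[w] and finite-dimensionality criteria -/

section Finiteness

variable {f : k[X]}

local notation "𝐱" => gen f Gen.x
local notation "𝐲" => gen f Gen.y
local notation "𝐳" => gen f Gen.z

theorem lin_wPoly {M N : GrMod (grading f)} (g : M ⟶ N) (p : k[X]) (v : M.carrier) :
    lin g (wPoly M p v) = wPoly N p (lin g v) := by
  have hw : ∀ v, lin g (wOp M v) = wOp N (lin g v) := by
    intro v
    induction v using GrMod.induction_on with
    | hom n v hv => rw [wOp_of_mem hv, wOp_of_mem (lin_mem g hv), map_sub, map_smul, lin_smul]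
    | add v w hv hw => simp only [map_add, hv, hw]
  induction p using Polynomial.induction_on generalizing v with
  | C c => simp [wPoly, Module.algebraMap_end_apply]
  | add p q hp hq => simp only [map_add, LinearMap.add_apply, hp, hq]
  | monomial n c h =>
    rw [pow_succ, ← mul_assoc, wPoly_mul M (C c * X ^ n), wPoly_mul N (C c * X ^ n), h]
    simp [wPoly, hw]

/-- The endomorphism of a graded module given by a polynomial in `wOp`. -/
noncomputable def wHom (M : GrMod (grading f)) (p : k[X]) : M ⟶ M :=
  mkHom (wPoly M p) fun _ _ hv => wPoly_mem hv p

theorem wPoly_X_sub_C (M : GrMod (grading f)) (c : k) (v : M.carrier) :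
    wPoly M (X - C c) v = wOp M v - c • v := by
  simp [wPoly, Module.algebraMap_end_apply]

theorem wPoly_of_scalar {M : GrMod (grading f)} {c : k} (h : ∀ v, wOp M v = c • v) (p : k[X])
    (v : M.carrier) : wPoly M p v = p.eval c • v := by
  induction p using Polynomial.induction_on generalizing v with
  | C c => simp [wPoly, Module.algebraMap_end_apply]
  | add p q hp hq => simp only [map_add, LinearMap.add_apply, hp, hq, eval_add, add_smul]
  | monomial n a ih =>
    rw [pow_succ, ← mul_assoc, wPoly_mul, ih]
    simp [wPoly, h, smul_smul]

theorem op_aeval_smul_of_scalar {M : GrMod (grading f)} {c : k} (h : ∀ v, wOp M v = c • v) {n : ℤ}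
    {v : M.carrier} (hv : v ∈ M.deg n) (p : k[X]) :
    op (aeval 𝐳 p) • v = p.eval (c + n) • v := by
  rw [op_aeval_smul hv, wPoly_of_scalar h]
  simp

theorem wOp_eq_smul_of_surjective {M N : GrMod (grading f)} {c : k} (g : M ⟶ N)
    (hg : Function.Surjective (lin g)) (h : ∀ v, lin g (wPoly M (X - C c) v) = 0)
    (v : N.carrier) : wOp N v = c • v := by
  obtain ⟨v, rfl⟩ := hg v
  have := h v
  rwa [lin_wPoly, wPoly_X_sub_C, sub_eq_zero] at this

theorem exists_op_smul_eq_wPoly {M : GrMod (grading f)} {d j : ℤ} {e : M.carrier}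
    (he : e ∈ M.deg d) {a : GWA f} (ha : a ∈ grading f j) :
    ∃ q, op a • e = wPoly M q (op (mono f j) • e) := by
  obtain ⟨p, rfl⟩ := exists_eq_aeval_mul_mono f ha
  exact ⟨_, by rw [op_mul_smul, op_aeval_smul he p, ← map_smul]⟩

theorem proj_op_smul_of_mem {M : GrMod (grading f)} {d : ℤ} {e : M.carrier} (he : e ∈ M.deg d)
    (a : GWA f) (n : ℤ) : M.proj n (op a • e) = op (GradedRing.proj (grading f) (n - d) a) • e := by
  induction a using DirectSum.Decomposition.inductionOn (grading f) with
  | zero => simp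
  | @homogeneous j a =>
    rw [GradedRing.proj_apply, proj_op_smul a.2]
    by_cases h : d = n - j
    · rw [← h, proj_of_mem he, show n - d = j by omega, DirectSum.decompose_of_mem_same _ a.2]
    · rw [proj_of_mem_ne h he, DirectSum.decompose_of_mem_ne _ a.2 (by omega)]
      simp
  | add a b ha hb =>
    rw [MulOpposite.op_add, add_smul, map_add, ha, hb, map_add, MulOpposite.op_add, add_smul]

/-- Each component is finitely generated over k[w]: the coefficient of a generator can be cut to its
component of the right degree, which is a polynomial in z times one monomial, and z is w plus a
constant. -/
theorem exists_eq_sum_wPoly {M : GrMod (grading f)} {r : ℕ} {d : Fin r → ℤ} {s : Fin r → M.carrier}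
    (hd : ∀ i, s i ∈ M.deg (d i)) (hs : Submodule.span (GWA f)ᵐᵒᵖ (Set.range s) = ⊤) {n : ℤ}
    {v : M.carrier} (hv : v ∈ M.deg n) :
    ∃ p : Fin r → k[X], v = ∑ i, wPoly M (p i) (op (mono f (n - d i)) • s i) := by
  obtain ⟨c, hc⟩ := (Submodule.mem_span_range_iff_exists_fun _).1
    (hs ▸ Submodule.mem_top : v ∈ Submodule.span (GWA f)ᵐᵒᵖ (Set.range s))
  choose p hp using fun i => exists_op_smul_eq_wPoly (hd i)
    (DirectSum.decompose (grading f) (unop (c i)) (n - d i)).2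
  refine ⟨p, ?_⟩
  rw [← proj_of_mem hv, ← hc, map_sum]
  refine Finset.sum_congr rfl fun i _ => ?_
  rw [← hp, ← op_unop (c i), proj_op_smul_of_mem (hd i), GradedRing.proj_apply, unop_op]

/-- If `wOp - c` is surjective, then `wOp` is annihilated by a nonzero polynomial. -/
theorem exists_wPoly_eq_zero {M : GrMod (grading f)} {c : k}
    (h : ∀ v, ∃ w, wPoly M (X - C c) w = v) : ∃ p : k[X], p ≠ 0 ∧ ∀ v, wPoly M p v = 0 := by
  obtain ⟨r, d, s, hd, hs⟩ := M.exists_generators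
  -- With X acting as w, commutative algebra applies to each component separately.
  let : Module k[X] M.carrier := Module.compHom M.carrier (wPoly M).toRingHom
  have hsmul : ∀ (p : k[X]) (v : M.carrier), p • v = wPoly M p v := fun _ _ => rfl
  have key : ∀ i, ∃ p : k[X], p ≠ 0 ∧ wPoly M p (s i) = 0 := by
    intro i
    let N : Submodule k[X] M.carrier :=
      Submodule.span k[X] (Set.range fun j => op (mono f (d i - d j)) • s j)
    have hN : ∀ v ∈ M.deg (d i), v ∈ N := by
      intro v hv
      obtain ⟨p, hp⟩ := exists_eq_sum_wPoly hd hs hv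
      rw [hp]
      exact sum_mem fun j _ => N.smul_mem (p j) (Submodule.subset_span ⟨j, rfl⟩)
    have hdeg : ∀ j, op (mono f (d i - d j)) • s j ∈ M.deg (d i) := fun j => by
      simpa using M.op_smul_mem (hd j) (mono_mem f (d i - d j))
    -- Nakayama's lemma: N = (X - c)N yields p ≡ 1 modulo X - c killing N. Such p is nonzero because
    -- X - c is not a unit.
    obtain ⟨p, hp, hpN⟩ := Submodule.exists_sub_one_mem_and_smul_eq_zero_of_fg_of_le_smul
      (Ideal.span {X - C c}) N (Submodule.fg_span (Set.finite_range _)) (by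
        refine Submodule.span_le.2 ?_
        rintro _ ⟨j, rfl⟩
        obtain ⟨w, hw⟩ := h (op (mono f (d i - d j)) • s j)
        have hw' : wPoly M (X - C c) (M.proj (d i) w) = op (mono f (d i - d j)) • s j := by
          have := lin_proj (wHom M (X - C c)) (d i) w
          refine this.trans ?_
          rw [wHom, lin_mkHom, hw, proj_of_mem (hdeg j)]
        dsimp only
        rw [SetLike.mem_coe, ← hw', ← hsmul]
        exact Submodule.smul_mem_smul (Ideal.subset_span rfl) (hN _ (M.proj_mem _ _)))
    refine ⟨p, ?_, hpN _ (hN _ (hd i))⟩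
    rintro rfl
    rw [Ideal.mem_span_singleton, zero_sub, dvd_neg] at hp
    exact not_isUnit_X_sub_C c (isUnit_of_dvd_one hp)
  choose p hp0 hp using key
  refine ⟨∏ i, p i, Finset.prod_ne_zero_iff.2 fun i _ => hp0 i, ?_⟩
  have : LinearMap.ker (wPoly M (∏ i, p i)) = ⊤ := by
    rw [eq_top_iff, ← hs, Submodule.span_le]
    rintro _ ⟨i, rfl⟩
    rw [SetLike.mem_coe, LinearMap.mem_ker, ← Finset.prod_erase_mul _ _ (Finset.mem_univ i),
      wPoly_mul, hp, map_zero]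
  exact fun v => LinearMap.mem_ker.1 (this ▸ Submodule.mem_top)

/-- Dévissage: a torsion module is finite-dimensional if its subquotients on which `wOp` is a
scalar are. -/
theorem finDim_of_wPoly_eq_zero [IsAlgClosed k] (K : GrMod (grading f) → Prop)
    (hK : ∀ {M N : GrMod (grading f)} (g : M ⟶ N), Function.Surjective (lin g) → K M → K N)
    (hfin : ∀ M (c : k), K M → (∀ v, wOp M v = c • v) → M.FinDim) {M : GrMod (grading f)}
    (hM : K M) {p : k[X]} (hp : p ≠ 0) (h : ∀ v, wPoly M p v = 0) : M.FinDim := by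
  have hsplit := (IsAlgClosed.splits p).eq_prod_roots
  have h' : ∀ v, wPoly M (p.roots.map fun a => X - C a).prod v = 0 := by
    intro v
    have := h v
    rw [hsplit, wPoly_mul, wPoly, Polynomial.aeval_C, Module.algebraMap_end_apply] at this
    exact (smul_eq_zero.1 this).resolve_left (leadingCoeff_ne_zero.2 hp)
  clear h hsplit
  generalize p.roots = s at h'
  -- Peel off one root c: (w - c)M is killed by the remaining factors, and w is the scalar c on M/(w
  -- - c)M. Both are quotients of M, so both inherit K.
  induction s using Multiset.induction_on generalizing M with
  | empty =>
    have : Subsingleton M.carrier := subsingleton_of_forall_eq 0 fun v => by simpa using h' v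
    infer_instance
  | cons c s ih =>
    let g := wHom M (X - C c)
    have h₁ : (range g).FinDim := by
      refine ih (hK _ (lin_toRange_surjective g) hM) fun v => ?_
      obtain ⟨v, rfl⟩ := lin_toRange_surjective g v
      refine lin_rangeι_injective g ?_
      rw [map_zero, lin_wPoly]
      refine Eq.trans ?_ (h' v)
      rw [Multiset.map_cons, Multiset.prod_cons, mul_comm, wPoly_mul]
      rfl
    have h₂ : (coker g).FinDim := hfin _ c (hK _ (lin_quotMk_surjective _ _ _) hM)
      (wOp_eq_smul_of_surjective (cokerπ g) (lin_quotMk_surjective _ _ _) fun v =>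
        lin_quotMk_eq_zero.2 ⟨v, rfl⟩)
    exact finite_of_exact (klin (rangeι g)) (klin (cokerπ g)) fun v hv =>
      ⟨⟨v, lin_quotMk_eq_zero.1 hv⟩, rfl⟩

/-- Only finitely many components are nonzero. -/
def IsBounded (M : GrMod (grading f)) : Prop :=
  ∃ B : ℤ, ∀ n, B < |n| → ∀ v ∈ M.deg n, v = 0

theorem IsBounded.of_surjective {M N : GrMod (grading f)} (g : M ⟶ N)
    (hg : Function.Surjective (lin g)) (hM : IsBounded M) : IsBounded N := by
  obtain ⟨B, hB⟩ := hM
  refine ⟨B, fun n hn v hv => ?_⟩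
  obtain ⟨v, rfl⟩ := hg v
  rw [← proj_of_mem hv, ← lin_proj, hB n hn _ (M.proj_mem n v), map_zero]

theorem IsBounded.of_finDim {M : GrMod (grading f)} (hM : M.FinDim) : IsBounded M := by
  have h := WellFoundedGT.finite_ne_bot_of_iSupIndep M.isInternal.submodule_iSupIndep
  obtain ⟨B, hB⟩ := (h.image abs).bddAbove
  refine ⟨B, fun n hn v hv => ?_⟩
  by_contra hv'
  have : M.deg n ≠ ⊥ := fun hbot => hv' ((Submodule.mem_bot k).1 (hbot ▸ hv))
  exact absurd (hB ⟨n, this, rfl⟩) (not_le.2 hn)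

/-- When w is a scalar, finite generation of a component over k[w] is finite-dimensionality over k.
-/
theorem IsBounded.finDim_of_scalar {M : GrMod (grading f)} (hM : IsBounded M) {c : k}
    (h : ∀ v, wOp M v = c • v) : M.FinDim := by
  obtain ⟨B, hB⟩ := hM
  obtain ⟨r, d, s, hd, hs⟩ := M.exists_generators
  refine ⟨Submodule.fg_def.2 ⟨Set.range fun q : Finset.Icc (-B) B × Fin r =>
    op (mono f (q.1 - d q.2)) • s q.2, Set.finite_range _, ?_⟩⟩
  rw [eq_top_iff]
  rintro v -
  induction v using GrMod.induction_on with
  | add v w hv hw => exact add_mem hv hw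
  | hom n v hv =>
    by_cases hn : B < |n|
    · rw [hB n hn v hv]
      exact zero_mem _
    · obtain ⟨p, hp⟩ := exists_eq_sum_wPoly hd hs hv
      rw [hp]
      refine sum_mem fun i _ => ?_
      rw [wPoly_of_scalar h]
      exact Submodule.smul_mem _ _ (Submodule.subset_span
        ⟨⟨⟨n, Finset.mem_Icc.2 (abs_le.1 (not_lt.1 hn))⟩, i⟩, rfl⟩)

/-- Degree n is spanned over k[w] by the generators times monomials of degree n - d i; once |n|
exceeds the bound, these monomials contain x^N or y^N as their first factor. -/
theorem IsBounded.of_generators {M : GrMod (grading f)} {r : ℕ} {d : Fin r → ℤ}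
    {s : Fin r → M.carrier} (hd : ∀ i, s i ∈ M.deg (d i))
    (hs : Submodule.span (GWA f)ᵐᵒᵖ (Set.range s) = ⊤) (N : ℕ)
    (hx : ∀ i, op (𝐱 ^ N) • s i = 0) (hy : ∀ i, op (𝐲 ^ N) • s i = 0) : IsBounded M := by
  refine ⟨N + ∑ i, |d i|, fun n hn v hv => ?_⟩
  obtain ⟨p, hp⟩ := exists_eq_sum_wPoly hd hs hv
  rw [hp]
  refine Finset.sum_eq_zero fun i _ => ?_
  have hi : |d i| ≤ ∑ i, |d i| :=
    Finset.single_le_sum (fun j _ => abs_nonneg (d j)) (Finset.mem_univ i)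
  suffices op (mono f (n - d i)) • s i = 0 by rw [this, map_zero]
  have hlt : (N : ℤ) < |n - d i| := by
    have := abs_sub_abs_le_abs_sub n (d i)
    linarith
  obtain ⟨j, hj | hj⟩ := (n - d i).eq_nat_or_neg
  · rw [hj, Nat.abs_cast, Nat.cast_lt] at hlt
    rw [hj, mono_natCast, ← Nat.add_sub_of_le hlt.le, pow_add, op_mul_smul, hx, smul_zero]
  · rw [hj, abs_neg, Nat.abs_cast, Nat.cast_lt] at hlt
    rw [hj, mono_neg_natCast, ← Nat.add_sub_of_le hlt.le, pow_add, op_mul_smul, hy, smul_zero]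

end Finiteness

end GWA

namespace GWA

open Polynomial GrMod MulOpposite

variable {k : Type u} [Field k]

/-! ### Submodules given degree by degree; modules trivial for a family -/

section Family

variable {f : k[X]}

/-- The submodule of elements whose homogeneous components lie in given subspaces, stable under
the generators. -/
def ofFamily (M : GrMod (grading f)) (D : ℤ → Submodule k M.carrier)
    (hD : ∀ (g : Gen.{u}) (n : ℤ), ∀ v ∈ M.deg n, v ∈ D n → op (gen f g) • v ∈ D (n + g.wt)) :
    Submodule (GWA f)ᵐᵒᵖ M.carrier where
  carrier := {v | ∀ n, M.proj n v ∈ D n}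
  zero_mem' n := by rw [map_zero]; exact zero_mem _
  add_mem' hv hw n := by rw [map_add]; exact add_mem (hv n) (hw n)
  smul_mem' a v hv := by
    obtain ⟨a, rfl⟩ := op_surjective a
    have hgen : ∀ (g : Gen.{u}) (v : M.carrier), (∀ n, M.proj n v ∈ D n) →
        ∀ n, M.proj n (op (gen f g) • v) ∈ D n := by
      intro g v hv n
      rw [proj_op_smul (gen_mem f g)]
      simpa using hD g _ _ (M.proj_mem (n - g.wt) v) (hv (n - g.wt))
    change ∀ n, _
    induction a using GWA.induction generalizing v with
    | hx => exact hgen _ v hv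
    | hy => exact hgen _ v hv
    | hz => exact hgen _ v hv
    | hc c =>
      intro n
      rw [op_algebraMap_smul, map_smul]
      exact Submodule.smul_mem _ _ (hv n)
    | hadd a b ha hb =>
      intro n
      rw [MulOpposite.op_add, add_smul, map_add]
      exact add_mem (ha v hv n) (hb v hv n)
    | hmul a b ha hb =>
      intro n
      rw [op_mul_smul]
      exact hb _ (ha v hv) n

theorem mem_ofFamily {M : GrMod (grading f)} {D : ℤ → Submodule k M.carrier}
    {hD : ∀ (g : Gen.{u}) (n : ℤ), ∀ v ∈ M.deg n, v ∈ D n → op (gen f g) • v ∈ D (n + g.wt)}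
    {n : ℤ} {v : M.carrier} (hv : v ∈ M.deg n) : v ∈ ofFamily M D hD ↔ v ∈ D n := by
  constructor
  · intro h
    have := h n
    rwa [proj_of_mem hv] at this
  · intro h j
    by_cases hj : n = j
    · subst hj
      rwa [proj_of_mem hv]
    · rw [proj_of_mem_ne hj hv]
      exact zero_mem _

theorem isHomog_ofFamily (M : GrMod (grading f)) (D : ℤ → Submodule k M.carrier)
    (hD : ∀ (g : Gen.{u}) (n : ℤ), ∀ v ∈ M.deg n, v ∈ D n → op (gen f g) • v ∈ D (n + g.wt)) :
    M.IsHomog (ofFamily M D hD) :=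
  fun n v hv => (mem_ofFamily (M.proj_mem n v)).2 (hv n)

/-- Right multiplication by an element of the algebra. -/
def ract (M : GrMod (grading f)) (a : GWA f) : M.carrier →ₗ[k] M.carrier where
  toFun v := op a • v
  map_add' := smul_add _
  map_smul' c v := op_smul_smul a c v

theorem ract_apply (M : GrMod (grading f)) (a : GWA f) (v : M.carrier) :
    ract M a v = op a • v := rfl

/-- No nonzero morphisms from the members of a family. -/
def IsTrivialFor {I : Type w} (P : I → GrMod (grading f)) (V : GrMod (grading f)) : Prop :=
  ∀ i (g : P i ⟶ V), g = 0

/-- A morphism from a projective member to N lifts to M, where it is zero. This closure under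
quotients drives all the arguments below. -/
theorem IsTrivialFor.of_surjective {I : Type w} {P : I → GrMod (grading f)}
    [∀ i, Projective (P i)] {M N : GrMod (grading f)} (g : M ⟶ N)
    (hg : Function.Surjective (lin g)) (hM : IsTrivialFor P M) : IsTrivialFor P N := by
  intro i h
  have := epi_of_surjective g hg
  rw [← Projective.factorThru_comp h g, hM i (Projective.factorThru h g), Limits.zero_comp]

end Family

/-! ### Detecting families for f = z(z + m) -/

section Quadratic

variable {m : ℕ}

local notation "𝐱" => gen (quad k m) Gen.x
local notation "𝐲" => gen (quad k m) Gen.y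
local notation "𝐳" => gen (quad k m) Gen.z

theorem eval_quad (m : ℕ) (c : k) : (quad k m).eval c = c * (c + m) := by simp [quad]

theorem quad_ne_zero (m : ℕ) : quad k m ≠ 0 := mul_ne_zero X_ne_zero (X_add_C_ne_zero _)

/-- A family of projective graded modules which detects the simple modules of infinite
dimension. -/
structure Detects {I : Type w} (P : I → GrMod (grading (quad k m))) : Prop where
  projective : ∀ i, Projective (P i)
  x : ∀ V, IsTrivialFor P V → ∀ n, ∀ e ∈ V.deg n, op 𝐱 • e = 0 → op 𝐳 • e = -(m : k) • e → e = 0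
  y : ∀ V, IsTrivialFor P V → ∀ n, ∀ e ∈ V.deg n, op 𝐲 • e = 0 → op 𝐳 • e = e → e = 0
  generic : ∀ V, IsTrivialFor P V → ∀ c : k, (∀ j : ℤ, c ≠ j) → (∀ v, wOp V v = c • v) →
    ∀ v : V.carrier, v = 0

section Scalar

variable {V : GrMod (grading (quad k m))} {c : k}

theorem op_z_smul_of_scalar (h : ∀ v, wOp V v = c • v) {n : ℤ} {v : V.carrier}
    (hv : v ∈ V.deg n) : op 𝐳 • v = (c + n) • v := by
  have := op_aeval_smul_of_scalar h hv X
  rwa [aeval_X, eval_X] at this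

theorem op_y_op_x_smul (h : ∀ v, wOp V v = c • v) {n : ℤ} {v : V.carrier}
    (hv : v ∈ V.deg n) : op 𝐲 • op 𝐱 • v = ((c + n) * (c + n + m)) • v := by
  rw [← op_mul_smul, x_mul_y, op_aeval_smul_of_scalar h hv, eval_quad]

theorem op_x_op_y_smul (h : ∀ v, wOp V v = c • v) {n : ℤ} {v : V.carrier}
    (hv : v ∈ V.deg n) : op 𝐱 • op 𝐲 • v = ((c + n - 1) * (c + n - 1 + m)) • v := by
  rw [← op_mul_smul, y_mul_x, op_aeval_smul_of_scalar h hv, eval_comp, eval_quad]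
  simp

variable {I : Type w} {P : I → GrMod (grading (quad k m))}

/-- The right tail vanishes. In degree 1 - l, z acts as 1, so only killing by y is missing before
detection applies; it is obtained by first passing to a quotient. In degree 1 - l + (j+1), induction
gives vy = 0, while vyx = (j+1)(j+1+m)v with nonzero coefficient in characteristic zero. -/
theorem eq_zero_of_right [CharZero k] (hP : Detects P) (hV : IsTrivialFor P V) {l : ℤ}
    (h : ∀ v, wOp V v = (l : k) • v) (j : ℕ) :
    ∀ v ∈ V.deg (1 - l + j), v = 0 := by
  have := hP.projective
  induction j with
  | succ j ih =>
    intro v hv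
    have hy : op 𝐲 • v = 0 := ih _ (by
      have := V.op_smul_mem hv (gen_mem _ Gen.y)
      rwa [show 1 - l + ((j + 1 : ℕ) : ℤ) + Gen.y.wt = 1 - l + j by
        simp only [Gen.wt]; push_cast; ring] at this)
    have h₁ := op_x_op_y_smul h hv
    rw [hy, smul_zero] at h₁
    refine (smul_eq_zero.1 h₁.symm).resolve_left ?_
    push_cast
    have h₂ : (j : k) + 1 ≠ 0 := Nat.cast_add_one_ne_zero j
    have h₃ : (j : k) + 1 + m ≠ 0 := by exact_mod_cast (by omega : j + 1 + m ≠ 0)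
    convert mul_ne_zero h₂ h₃ using 2
    all_goals ring
  | zero =>
    have hz : ∀ {W : GrMod (grading (quad k m))} (_ : ∀ v, wOp W v = (l : k) • v) {v : W.carrier},
        v ∈ W.deg (1 - l + (0 : ℕ)) → op 𝐳 • v = v := by
      intro W hW v hv
      rw [op_z_smul_of_scalar hW hv]
      simp
    -- All of the degrees at most -l, and above them the elements that y^(n+l) carries to zero in
    -- degree -l.
    let D (n : ℤ) : Submodule k V.carrier :=
      ⨅ _ : -l < n, LinearMap.ker (ract V (𝐲 ^ (n + l).toNat))
    have hD : ∀ {n v}, v ∈ D n ↔ (-l < n → op (𝐲 ^ (n + l).toNat) • v = 0) := by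
      simp [D, Submodule.mem_iInf, ract_apply]
    have hDgen : ∀ (g : Gen.{u}) (n : ℤ), ∀ v ∈ V.deg n, v ∈ D n →
        op (gen (quad k m) g) • v ∈ D (n + g.wt) := by
      intro g n v hv hvD
      rw [hD] at hvD ⊢
      cases g with
      | z =>
        simp only [Gen.wt, add_zero]
        intro hn
        rw [op_z_smul_of_scalar h hv, op_smul_smul, hvD hn, smul_zero]
      | x =>
        simp only [Gen.wt]
        intro hn
        rw [show (n + 1 + l).toNat = (n + l).toNat + 1 by omega, pow_succ', op_mul_smul,
          op_y_op_x_smul h hv, op_smul_smul]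
        by_cases hn' : -l < n
        · rw [hvD hn', smul_zero]
        -- The only step by x that could leave the submodule is from degree -l to 1 - l; there the
        -- coefficient (l+n)(l+n+m) vanishes.
        · rw [show n = -l by omega]
          simp
      | y =>
        simp only [Gen.wt]
        intro hn
        rw [← op_mul_smul, ← pow_succ', show (n + -1 + l).toNat + 1 = (n + l).toNat by omega]
        exact hvD (by omega)
    let N := ofFamily V D hDgen
    let q := V.quotMk N (isHomog_ofFamily V D hDgen)
    have hq : Function.Surjective (lin q) := lin_quotMk_surjective _ _ _
    have hscal : ∀ v, wOp (V.quot N (isHomog_ofFamily V D hDgen)) v = (l : k) • v :=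
      wOp_eq_smul_of_surjective q hq fun v => by
        rw [wPoly_X_sub_C, h, sub_self, map_zero]
    -- Detection is used twice. Modulo N the class of v is killed by y, because degree -l lies in N;
    -- hence v ∈ N, which says vy = 0. Then detection in V itself gives v = 0.
    intro v hv
    have hyN : op 𝐲 • v ∈ N := (mem_ofFamily (V.op_smul_mem hv (gen_mem _ Gen.y))).2
      (hD.2 fun hn => by simp [Gen.wt] at hn)
    have hvN : lin q v = 0 := by
      refine hP.y _ (hV.of_surjective q hq) _ _ (lin_mem q hv) ?_ (hz hscal (lin_mem q hv))
      rw [← map_smul]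
      exact lin_quotMk_eq_zero.2 hyN
    have hv' := hD.1 ((mem_ofFamily hv).1 (lin_quotMk_eq_zero.1 hvN)) (by simp)
    refine hP.y _ hV _ _ hv ?_ (hz h hv)
    simpa using hv'

/-- Mirror image of `eq_zero_of_right`: x replaces y, and the break lies between degrees -l-m and
1-l-m, where z acts on the lower side as -m. -/
theorem eq_zero_of_left [CharZero k] (hP : Detects P) (hV : IsTrivialFor P V) {l : ℤ}
    (h : ∀ v, wOp V v = (l : k) • v) (j : ℕ) :
    ∀ v ∈ V.deg (-l - m - j), v = 0 := by
  have := hP.projective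
  induction j with
  | succ j ih =>
    intro v hv
    have hx : op 𝐱 • v = 0 := ih _ (by
      have := V.op_smul_mem hv (gen_mem _ Gen.x)
      rwa [show -l - m - ((j + 1 : ℕ) : ℤ) + Gen.x.wt = -l - m - j by
        simp only [Gen.wt]; push_cast; ring] at this)
    have h₁ := op_y_op_x_smul h hv
    rw [hx, smul_zero] at h₁
    refine (smul_eq_zero.1 h₁.symm).resolve_left ?_
    push_cast
    have h₂ : (j : k) + 1 ≠ 0 := Nat.cast_add_one_ne_zero j
    have h₃ : (j : k) + 1 + m ≠ 0 := by exact_mod_cast (by omega : j + 1 + m ≠ 0)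
    convert mul_ne_zero (neg_ne_zero.2 h₃) (neg_ne_zero.2 h₂) using 2
    all_goals ring
  | zero =>
    have hz : ∀ {W : GrMod (grading (quad k m))} (_ : ∀ v, wOp W v = (l : k) • v) {v : W.carrier},
        v ∈ W.deg (-l - m - (0 : ℕ)) → op 𝐳 • v = -(m : k) • v := by
      intro W hW v hv
      rw [op_z_smul_of_scalar hW hv]
      congr 1
      push_cast
      ring
    let D (n : ℤ) : Submodule k V.carrier :=
      ⨅ _ : n < 1 - l - m, LinearMap.ker (ract V (𝐱 ^ (1 - l - m - n).toNat))
    have hD : ∀ {n v}, v ∈ D n ↔ (n < 1 - l - m → op (𝐱 ^ (1 - l - m - n).toNat) • v = 0) := by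
      simp [D, Submodule.mem_iInf, ract_apply]
    have hDgen : ∀ (g : Gen.{u}) (n : ℤ), ∀ v ∈ V.deg n, v ∈ D n →
        op (gen (quad k m) g) • v ∈ D (n + g.wt) := by
      intro g n v hv hvD
      rw [hD] at hvD ⊢
      cases g with
      | z =>
        simp only [Gen.wt, add_zero]
        intro hn
        rw [op_z_smul_of_scalar h hv, op_smul_smul, hvD hn, smul_zero]
      | x =>
        simp only [Gen.wt]
        intro hn
        rw [← op_mul_smul, ← pow_succ',
          show (1 - l - m - (n + 1)).toNat + 1 = (1 - l - m - n).toNat by omega]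
        exact hvD (by omega)
      | y =>
        simp only [Gen.wt]
        intro hn
        rw [show (1 - l - m - (n + -1)).toNat = (1 - l - m - n).toNat + 1 by omega, pow_succ',
          op_mul_smul, op_x_op_y_smul h hv, op_smul_smul]
        by_cases hn' : n < 1 - l - m
        · rw [hvD hn', smul_zero]
        · rw [show n = 1 - l - m by omega]
          push_cast
          rw [show (l : k) + (1 - l - m) - 1 + m = 0 by ring, mul_zero, zero_smul]
    let N := ofFamily V D hDgen
    let q := V.quotMk N (isHomog_ofFamily V D hDgen)
    have hq : Function.Surjective (lin q) := lin_quotMk_surjective _ _ _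
    have hscal : ∀ v, wOp (V.quot N (isHomog_ofFamily V D hDgen)) v = (l : k) • v :=
      wOp_eq_smul_of_surjective q hq fun v => by
        rw [wPoly_X_sub_C, h, sub_self, map_zero]
    intro v hv
    have hxN : op 𝐱 • v ∈ N := (mem_ofFamily (V.op_smul_mem hv (gen_mem _ Gen.x))).2
      (hD.2 fun hn => by simp [Gen.wt] at hn; omega)
    have hvN : lin q v = 0 := by
      refine hP.x _ (hV.of_surjective q hq) _ _ (lin_mem q hv) ?_ (hz hscal (lin_mem q hv))
      rw [← map_smul]
      exact lin_quotMk_eq_zero.2 hxN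
    have hv' := hD.1 ((mem_ofFamily hv).1 (lin_quotMk_eq_zero.1 hvN)) (by simp)
    refine hP.x _ hV _ _ hv ?_ (hz h hv)
    simpa using hv'

/-- A nonintegral eigenvalue gives V = 0. For c = l both tails vanish, leaving the degrees with -l-m
< n < 1-l. -/
theorem finDim_of_scalar [CharZero k] (hP : Detects P) (hV : IsTrivialFor P V)
    (h : ∀ v, wOp V v = c • v) : V.FinDim := by
  by_cases hc : ∀ j : ℤ, c ≠ j
  · have : Subsingleton V.carrier := subsingleton_of_forall_eq 0 (hP.generic V hV c hc h)
    infer_instance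
  · push Not at hc
    obtain ⟨l, rfl⟩ := hc
    refine IsBounded.finDim_of_scalar ⟨|l| + m, fun n hn v hv => ?_⟩ h
    obtain hn | hn := lt_abs.1 hn
    · obtain ⟨j, hj⟩ := Int.eq_ofNat_of_zero_le
        (show 0 ≤ n - (1 - l) by have := neg_abs_le l; omega)
      exact eq_zero_of_right hP hV h j v (by rwa [show 1 - l + (j : ℤ) = n by omega])
    · obtain ⟨j, hj⟩ := Int.eq_ofNat_of_zero_le
        (show 0 ≤ -l - m - n by have := le_abs_self l; omega)
      exact eq_zero_of_left hP hV h j v (by rwa [show -l - m - (j : ℤ) = n by omega])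

end Scalar

variable {I : Type w} {P : I → GrMod (grading (quad k m))}

theorem half_ne_intCast [CharZero k] (j : ℤ) : (1 / 2 : k) ≠ j := by
  intro h
  have h2 : (2 : k) ≠ 0 := two_ne_zero
  have : (1 : k) = j * 2 := by rw [← h]; field_simp
  have : (1 : ℤ) = j * 2 := by exact_mod_cast this
  omega

/-- Any nonintegral scalar c would do; 1/2 is one in characteristic zero. The quotient V/(w - c)V is
trivial for the family with w = c, hence zero, so w - c is surjective on V. -/
theorem Detects.exists_wPoly [CharZero k] (hP : Detects P) {V : GrMod (grading (quad k m))}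
    (hV : IsTrivialFor P V) : ∃ p : k[X], p ≠ 0 ∧ ∀ v, wPoly V p v = 0 := by
  have := hP.projective
  refine exists_wPoly_eq_zero (c := 1 / 2) fun v => ?_
  let g := wHom V (X - C (1 / 2))
  have hq := lin_quotMk_surjective V _ (isHomog_range g)
  have h := hP.generic _ (hV.of_surjective (cokerπ g) hq) (1 / 2) half_ne_intCast
    (wOp_eq_smul_of_surjective (cokerπ g) hq fun v => lin_quotMk_eq_zero.2 ⟨v, rfl⟩)
  exact lin_quotMk_eq_zero.1 (h (lin (cokerπ g) v))

theorem Detects.finDim [IsAlgClosed k] [CharZero k] (hP : Detects P)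
    {V : GrMod (grading (quad k m))} (hV : IsTrivialFor P V) : V.FinDim := by
  have := hP.projective
  obtain ⟨p, hp, hpV⟩ := hP.exists_wPoly hV
  exact finDim_of_wPoly_eq_zero (IsTrivialFor P) (fun g hg h => h.of_surjective g hg)
    (fun M c hM h => finDim_of_scalar hP hM h) hV hp hpV

/-- Up to finite-dimensional modules, a detecting family generates. -/
theorem Detects.exists_finDim_coker [IsAlgClosed k] [CharZero k] (hP : Detects P)
    (M : GrMod (grading (quad k m))) :
    ∃ (n : ℕ) (s : Fin n → I) (g : pi (fun j => P (s j)) ⟶ M), (coker g).FinDim := by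
  have := hP.projective
  -- The sum of these images is the trace of the family in M. A morphism from a member to the
  -- quotient by the trace lifts to M, so it is zero.
  let T (a : Σ i, (P i ⟶ M)) := LinearMap.range (lin a.2)
  have hT : M.IsHomog (⨆ a, T a) := isHomog_iSup fun a => isHomog_range _
  let q := M.quotMk _ hT
  have hq : Function.Surjective (lin q) := lin_quotMk_surjective _ _ _
  have htriv : IsTrivialFor P (M.quot _ hT) := by
    intro i g
    have := epi_of_surjective q hq
    rw [← Projective.factorThru_comp g q]
    exact hom_ext fun v => lin_quotMk_eq_zero.2
      (Submodule.mem_iSup_of_mem ⟨i, Projective.factorThru g q⟩ ⟨v, rfl⟩)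
  obtain ⟨p, hp, hpV⟩ := hP.exists_wPoly htriv
  obtain ⟨B, hB⟩ := IsBounded.of_finDim (hP.finDim htriv)
  obtain ⟨r, d, s, hd, hs⟩ := M.exists_generators
  have hmono : ∀ j i, B < |d i + j| → op (mono (quad k m) j) • s i ∈ ⨆ a, T a := fun j i hj =>
    lin_quotMk_eq_zero.1 (hB _ hj _ (lin_mem q (M.op_smul_mem (hd i) (mono_mem _ j))))
  -- Large enough that degrees d i + N and d i - N lie outside the support of the quotient by the
  -- trace.
  let N : ℕ := (B + ∑ i, |d i| + 1).toNat
  have hN : ∀ i, B < |d i + N| ∧ B < |d i + -N| := by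
    intro i
    have hi : |d i| ≤ ∑ i, |d i| :=
      Finset.single_le_sum (fun j _ => abs_nonneg (d j)) (Finset.mem_univ i)
    have h₁ : B + ∑ i, |d i| + 1 ≤ N := Int.self_le_toNat _
    have h₂ := neg_abs_le (d i)
    have h₃ := le_abs_self (d i)
    exact ⟨lt_abs.2 (Or.inl (by linarith)), lt_abs.2 (Or.inr (by linarith))⟩
  -- A finitely generated part of the trace that suffices: modulo E the generators are killed by
  -- x^N, y^N and p(w), which forces finite dimension. Being finitely generated, E is compact, so
  -- finitely many of the images T contain it.
  let E : Submodule (GWA (quad k m))ᵐᵒᵖ M.carrier := ⨆ i : Fin r,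
    Submodule.span _ {op (𝐱 ^ N) • s i, op (𝐲 ^ N) • s i, wPoly M p (s i)}
  have hE : E ≤ ⨆ a, T a := by
    refine iSup_le fun i => Submodule.span_le.2 ?_
    rintro _ (rfl | rfl | rfl)
    · rw [← mono_natCast]; exact hmono _ _ (hN i).1
    · rw [← mono_neg_natCast]; exact hmono _ _ (hN i).2
    · refine lin_quotMk_eq_zero (hN := hT).1 ?_
      rw [lin_wPoly]
      exact hpV _
  have hEfg : E.FG := Submodule.fg_iSup _ fun i => Submodule.fg_span (Set.toFinite _)
  obtain ⟨t, ht⟩ := CompleteLattice.IsCompactElement.exists_finset_of_le_iSup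
    _ ((Submodule.fg_iff_compact E).1 hEfg) T hE
  let e := t.equivFin.symm
  let g := desc fun j : Fin t.card => (e j).1.2
  refine ⟨_, fun j => (e j).1.1, g, ?_⟩
  have hEg : E ≤ LinearMap.range (lin g) := by
    rw [range_desc]
    refine ht.trans (iSup₂_le fun a ha => ?_)
    have := le_iSup (fun j => T (e j)) (e.symm ⟨a, ha⟩)
    rwa [e.apply_symm_apply] at this
  have hmem : ∀ i, ∀ v ∈ ({op (𝐱 ^ N) • s i, op (𝐲 ^ N) • s i, wPoly M p (s i)} :
      Set M.carrier), lin (cokerπ g) v = 0 := fun i v hv =>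
    lin_quotMk_eq_zero.2 (hEg (Submodule.mem_iSup_of_mem i (Submodule.subset_span hv)))
  have hs' : Submodule.span (GWA (quad k m))ᵐᵒᵖ (Set.range fun i => lin (cokerπ g) (s i)) = ⊤ := by
    have h₁ := congrArg (Submodule.map (lin (cokerπ g))) hs
    rw [Submodule.map_span, ← Set.range_comp, Submodule.map_top, LinearMap.range_eq_top.2
      (lin_cokerπ_surjective g)] at h₁
    exact h₁
  have hbdd : IsBounded (coker g) := IsBounded.of_generators (fun i => lin_mem (cokerπ g) (hd i))
    hs' N (fun i => by rw [← map_smul]; exact hmem i _ (by simp))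
    (fun i => by rw [← map_smul]; exact hmem i _ (by simp))
  refine finDim_of_wPoly_eq_zero IsBounded (fun g hg h => h.of_surjective g hg)
    (fun M c hM h => hM.finDim_of_scalar h) hbdd hp fun v => ?_
  have hker : LinearMap.ker (wPoly (coker g) p) = ⊤ := by
    rw [eq_top_iff, ← hs', Submodule.span_le]
    rintro _ ⟨i, rfl⟩
    rw [SetLike.mem_coe, LinearMap.mem_ker, ← lin_wPoly]
    exact hmem i _ (by simp)
  exact LinearMap.mem_ker.1 (hker ▸ Submodule.mem_top)

end Quadratic

end GWA

namespace GWA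

open Polynomial GrMod MulOpposite

variable {k : Type u} [Field k]

/-! ### Divisibility by w - c in free modules -/

section Free

variable {f : k[X]}

local notation "𝐳" => gen f Gen.z

theorem coord_wPoly (d : ℤ) (c : k) (v : ((self (grading f)).shift d).carrier) :
    coord (wPoly _ (X - C c) v) = aeval 𝐳 (X - C ((d : k) + c)) * coord v := by
  conv_lhs => rw [← op_coord_smul_free1 v, map_smul, map_smul, wPoly_X_sub_C,
    wOp_of_mem (free1_mem d), sub_sub, ← add_smul, ← op_algebraMap_smul, map_sub, map_smul,
    map_smul, coord_free1]
  rw [op_smul_eq_mul, op_smul_eq_mul, op_smul_eq_mul, one_mul, one_mul, map_sub, aeval_X,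
    Polynomial.aeval_C]

/-- Under `rep` applied to 1, the operator w - c on a free module multiplies by a linear polynomial.
An element that is divisible by w - c indefinitely would have a nonzero polynomial image of
arbitrarily large degree. -/
theorem eq_zero_of_divisible (hf : f ≠ 0) {P : GrMod (grading f)} {d : ℤ}
    (g : P ⟶ (self (grading f)).shift d) {c : k} {n : ℤ}
    (h : ∀ p ∈ P.deg n, ∃ q ∈ P.deg n, wPoly P (X - C c) q = p) {p : P.carrier}
    (hp : p ∈ P.deg n) : lin g p = 0 := by
  have key : ∀ N : ℕ, ∀ p ∈ P.deg n, (rep f (coord (lin g p)) 1).natDegree < N →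
      rep f (coord (lin g p)) 1 = 0 := by
    intro N
    induction N with
    | zero => exact fun p _ h => absurd h (Nat.not_lt_zero _)
    | succ N ih =>
      intro p hp hlt
      obtain ⟨q, hq, rfl⟩ := h p hp
      rw [lin_wPoly, coord_wPoly, map_mul, Module.End.mul_apply, rep_aeval] at hlt ⊢
      by_cases h0 : rep f (coord (lin g q)) 1 = 0
      · rw [h0, mul_zero]
      · rw [natDegree_mul (X_sub_C_ne_zero _) h0, natDegree_X_sub_C] at hlt
        exact absurd (ih q hq (by omega)) h0
  rw [← op_coord_smul_free1 (lin g p), eq_zero_of_rep_one f hf (coord_mem (lin_mem g hp))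
    (key _ p hp (Nat.lt_succ_self _)), op_zero, zero_smul]

end Free

/-! ### Nonintegral eigenvalues -/

section Generic

variable {m : ℕ}

local notation "𝐱" => gen (quad k m) Gen.x
local notation "𝐲" => gen (quad k m) Gen.y
local notation "𝐳" => gen (quad k m) Gen.z

/-- The composites of x and y between neighbouring degrees are scalars whose factors are c plus
integers, so x and y are injective on homogeneous elements. -/
theorem op_mono_smul_ne_zero {V : GrMod (grading (quad k m))} {c : k} (hc : ∀ j : ℤ, c ≠ j)
    (h : ∀ v, wOp V v = c • v) (j : ℤ) {n : ℤ} {v : V.carrier} (hv : v ∈ V.deg n) (hv0 : v ≠ 0) :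
    op (mono (quad k m) j) • v ≠ 0 := by
  have hc' : ∀ j : ℤ, c + j ≠ 0 := fun j hj => hc (-j) (by
    push_cast
    exact eq_neg_of_add_eq_zero_left hj)
  have hx : ∀ {n} {v : V.carrier}, v ∈ V.deg n → v ≠ 0 → op 𝐱 • v ≠ 0 := by
    intro n v hv hv0 h0
    have h₁ := op_y_op_x_smul h hv
    rw [h0, smul_zero] at h₁
    refine hv0 ((smul_eq_zero.1 h₁.symm).resolve_left (mul_ne_zero (hc' n) ?_))
    have := hc' (n + m)
    push_cast at this
    rwa [add_assoc]
  have hy : ∀ {n} {v : V.carrier}, v ∈ V.deg n → v ≠ 0 → op 𝐲 • v ≠ 0 := by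
    intro n v hv hv0 h0
    have h₁ := op_x_op_y_smul h hv
    rw [h0, smul_zero] at h₁
    refine hv0 ((smul_eq_zero.1 h₁.symm).resolve_left (mul_ne_zero ?_ ?_))
    · have := hc' (n - 1)
      push_cast at this
      rwa [add_sub_assoc]
    · have := hc' (n - 1 + m)
      push_cast at this
      rwa [add_sub_assoc, add_assoc]
  obtain ⟨i, rfl | rfl⟩ := j.eq_nat_or_neg
  · induction i with
    | zero => simpa [mono] using hv0
    | succ i ih =>
      rw [mono_natCast] at ih ⊢
      rw [pow_succ, op_mul_smul]
      exact hx (V.op_smul_mem hv (SetLike.pow_mem_graded i (gen_mem _ _))) ih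
  · induction i with
    | zero => simpa [mono] using hv0
    | succ i ih =>
      rw [mono_neg_natCast] at ih ⊢
      rw [pow_succ, op_mul_smul]
      exact hy (V.op_smul_mem hv (SetLike.pow_mem_graded i (gen_mem _ _))) ih

/-- A nonzero projective module has nonzero morphisms to all modules on which `wOp` is a
non-integral scalar. -/
theorem eq_zero_of_projective {P : GrMod (grading (quad k m))} [Projective P] {p₀ : P.carrier}
    (hp₀ : p₀ ≠ 0) {V : GrMod (grading (quad k m))} (hPV : ∀ g : P ⟶ V, g = 0) {c : k}
    (hc : ∀ j : ℤ, c ≠ j) (h : ∀ v, wOp V v = c • v) (v₀ : V.carrier) : v₀ = 0 := by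
  by_contra hv₀
  obtain ⟨n₀, e₀, he₀, he₀0⟩ := exists_mem_deg_ne_zero hv₀
  have hV : ∀ n, ∃ v ∈ V.deg n, v ≠ 0 := fun n =>
    ⟨op (mono (quad k m) (n - n₀)) • e₀, by
      simpa using V.op_smul_mem he₀ (mono_mem (quad k m) (n - n₀)),
      op_mono_smul_ne_zero hc h _ he₀ he₀0⟩
  obtain ⟨r, d, s, hd, hs⟩ := P.exists_generators
  let F (i : Fin r) := (self (grading (quad k m))).shift (d i)
  let π : pi F ⟶ P := desc fun i => ofElem (s i) (hd i)
  have hπ : LinearMap.range (lin π) = ⊤ := by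
    rw [range_desc, eq_top_iff, ← hs, Submodule.span_le]
    rintro _ ⟨i, rfl⟩
    exact Submodule.mem_iSup_of_mem i ⟨_, lin_ofElem_free1 (s i) (hd i)⟩
  obtain ⟨σ, hσ⟩ := exists_lift π (𝟙 P) fun v => hπ ▸ Submodule.mem_top
  -- A coordinate of σ(p) has the form q(w) applied to a monomial. Sending the free generator to v
  -- maps it to q(c) times a nonzero vector; but morphisms from P to V vanish, so q(c) = 0 and X - c
  -- divides q.
  have hcoord : ∀ (i : Fin r) (n : ℤ), ∀ p ∈ P.deg n, ∃ b : (F i).carrier,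
      wPoly (F i) (X - C c) b = lin (σ ≫ prj F i) p := by
    intro i n p hp
    obtain ⟨v, hv, hv0⟩ := hV (d i)
    let u := lin (σ ≫ prj F i) p
    obtain ⟨q, hq⟩ := exists_op_smul_eq_wPoly (free1_mem (d i))
      (coord_mem (lin_mem (σ ≫ prj F i) hp))
    rw [op_coord_smul_free1] at hq
    have h₂ : lin (ofElem v hv) u = 0 :=
      LinearMap.congr_fun (congrArg lin (hPV ((σ ≫ prj F i) ≫ ofElem v hv))) p
    rw [show u = _ from hq, lin_wPoly, map_smul, lin_ofElem_free1, wPoly_of_scalar h] at h₂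
    have h₄ := (smul_eq_zero.1 h₂).resolve_right (op_mono_smul_ne_zero hc h _ hv hv0)
    obtain ⟨t, rfl⟩ := dvd_iff_isRoot.2 h₄
    exact ⟨_, by rw [hq, wPoly_mul]⟩
  -- Divisibility of σ(p) in the free module descends to P along π, since π ∘ σ is the identity.
  have hdiv : ∀ n, ∀ p ∈ P.deg n, ∃ q ∈ P.deg n, wPoly P (X - C c) q = p := by
    intro n p hp
    choose b hb using fun i => hcoord i n p hp
    let b' : (pi F).carrier := b
    refine ⟨P.proj n (lin π b'), P.proj_mem n _, ?_⟩
    have h₁ := lin_proj (wHom P (X - C c)) n (lin π b')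
    refine h₁.trans ?_
    have h₂ : wPoly (pi F) (X - C c) b' = lin σ p :=
      funext fun i => Eq.trans (lin_wPoly (prj F i) (X - C c) b') (hb i)
    have h₃ : lin π (lin σ p) = p := LinearMap.congr_fun (congrArg lin hσ) p
    rw [wHom, lin_mkHom, ← lin_wPoly, h₂, h₃, proj_of_mem hp]
  obtain ⟨n, e, he, he0⟩ := exists_mem_deg_ne_zero hp₀
  apply he0
  have h₃ : lin π (lin σ e) = e := LinearMap.congr_fun (congrArg lin hσ) e
  rw [← h₃]
  have h₄ : lin σ e = 0 := funext fun i =>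
    eq_zero_of_divisible (quad_ne_zero m) (σ ≫ prj F i) (hdiv n) he
  rw [h₄, map_zero]

end Generic

end GWA

theorem GrMod.eq_zero_of_generatesObj {k : Type u} [Field k] {f : Polynomial k} {I : Type w}
    {P : I → GrMod (GWA.grading f)} {M V : GrMod (GWA.grading f)} (hM : GeneratesObj P M)
    (hV : GWA.IsTrivialFor P V) (g : M ⟶ V) : g = 0 := by
  obtain ⟨n, s, c, hc, F, _⟩ := hM
  rw [← cancel_epi F, Limits.comp_zero]
  exact hc.hom_ext fun j => by rw [Limits.comp_zero]; exact hV _ _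

/-! ### From generation of X and Y to detection -/

section Cyclic

variable {k : Type u} [Field k] {R : Type u} [Ring R] [Algebra k R] {𝒜 : ℤ → Submodule k R}
  [GradedAlgebra 𝒜]

/-- Morphisms out of a shifted cyclic module. -/
theorem exists_hom_cyclicGr {S : Set R} (hS : ∀ s ∈ S, SetLike.IsHomogeneousElem 𝒜 s) {a b : ℤ}
    {M : GrMod 𝒜} {e : M.carrier} (he : e ∈ M.deg (a + b))
    (h : ∀ s ∈ S, MulOpposite.op s • e = 0) :
    ∃ g : ((cyclicGr 𝒜 S hS).shift a).shift b ⟶ M,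
      GrMod.lin g (Submodule.Quotient.mk (1 : R) : R ⧸ Submodule.span Rᵐᵒᵖ S) = e := by
  let φ : R →ₗ[Rᵐᵒᵖ] M.carrier := GrMod.lin (GrMod.ofElem e he)
  have hφ : Submodule.span Rᵐᵒᵖ S ≤ LinearMap.ker φ := Submodule.span_le.2 h
  refine ⟨GrMod.mkHom (M := ((cyclicGr 𝒜 S hS).shift a).shift b)
    ((Submodule.span Rᵐᵒᵖ S).liftQ φ hφ) ?_, one_smul _ e⟩
  rintro i _ ⟨v, hv, rfl⟩
  have := M.op_smul_mem he hv
  rwa [show a + b + (i - b - a) = i by ring] at this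

end Cyclic

namespace GWA

open Polynomial GrMod MulOpposite

variable {k : Type u} [Field k] {m : ℕ}

/-- An equation 1 = xa + (z+m)b would hold in degree 0 as 1 = x p(z) y + (z+m) q(z). The polynomial
representation then refutes it at the point -m. -/
theorem simpleX_ne_zero : (Submodule.Quotient.mk (1 : GWA (quad k m)) : GWA (quad k m) ⧸
    Submodule.span (GWA (quad k m))ᵐᵒᵖ
      {gen (quad k m) Gen.x, gen _ Gen.z + algebraMap k _ (m : k)}) ≠ 0 := by
  rw [Ne, Submodule.Quotient.mk_eq_zero, Submodule.mem_span_pair]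
  rintro ⟨a, b, h⟩
  obtain ⟨a, rfl⟩ := op_surjective a
  obtain ⟨b, rfl⟩ := op_surjective b
  rw [op_smul_eq_mul, op_smul_eq_mul] at h
  have hx : ∀ a, GradedRing.proj (grading (quad k m)) 0 (gen _ Gen.x * a) =
      gen _ Gen.x * (DirectSum.decompose (grading (quad k m)) a (-1) : GWA (quad k m)) := by
    intro a
    rw [GradedRing.proj_apply]
    exact DirectSum.coe_decompose_mul_add_of_left_mem (j := -1) _ (gen_mem (quad k m) Gen.x)
  have hz : ∀ b, GradedRing.proj (grading (quad k m)) 0 ((gen _ Gen.z + algebraMap k _ (m : k)) * b)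
      = (gen _ Gen.z + algebraMap k _ (m : k)) *
        (DirectSum.decompose (grading (quad k m)) b 0 : GWA (quad k m)) := fun b => by
    rw [GradedRing.proj_apply]
    exact DirectSum.coe_decompose_mul_add_of_left_mem (i := 0) (j := 0) _
      (add_mem (gen_mem (quad k m) Gen.z) (SetLike.algebraMap_mem_graded (grading (quad k m)) _))
  have h1 : GradedRing.proj (grading (quad k m)) 0 1 = 1 := by
    rw [GradedRing.proj_apply]
    exact DirectSum.decompose_of_mem_same _ SetLike.GradedOne.one_mem
  have h0 := congrArg (GradedRing.proj (grading (quad k m)) 0) h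
  obtain ⟨p, hp⟩ := exists_eq_aeval_mul_mono _ (DirectSum.decompose (grading (quad k m)) a (-1)).2
  obtain ⟨q, hq⟩ := exists_eq_aeval_mul_mono _ (DirectSum.decompose (grading (quad k m)) b 0).2
  rw [map_add, hx, hz, h1, hp, hq, mono_zero, mul_one, show (-1 : ℤ) = -(1 : ℕ) by rfl,
    mono_neg_natCast, pow_one] at h0
  -- The first term becomes p(z+1)f(z), which vanishes at -m because f(-m) = 0; the second contains
  -- the factor z + m.
  have h2 := congrArg (fun a => (rep (quad k m) a 1).eval (-(m : k))) h0
  simp only [map_add, map_mul, LinearMap.add_apply, Module.End.mul_apply, rep_gen, rep_aeval,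
    repGen_x, repGen_y, AlgHom.commutes, Module.algebraMap_end_apply, eval_add, eval_smul, map_one,
    Module.End.one_apply, eval_one] at h2
  simp [repGen, quad] at h2

theorem detects_of_generates {I : Type w} {P : I → GrMod (grading (quad k m))}
    (hP : ∀ i, Projective (P i)) (hX : ∀ n : ℤ, GeneratesObj P ((simpleX k m).shift n))
    (hY : ∀ n : ℤ, GeneratesObj P ((simpleY k m).shift n)) : Detects P where
  projective := hP
  x V hV n e he h₁ h₂ := by
    -- X has its generator in degree -m, so its shift by m + n has it in degree n.
    obtain ⟨g, hg⟩ := exists_hom_cyclicGr (𝒜 := grading (quad k m)) (a := -m) (b := m + n)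
      (S := {gen _ Gen.x, gen _ Gen.z + algebraMap k _ (m : k)})
      (by rintro s (rfl | rfl); exacts [isHom_x _, isHom_z_add _ _]) (e := e) (by simpa using he)
      (by
        rintro s (rfl | rfl)
        · exact h₁
        · rw [MulOpposite.op_add, add_smul, op_algebraMap_smul, h₂, neg_smul, neg_add_cancel])
    rw [← hg, eq_zero_of_generatesObj (hX (m + n)) hV g]
    rfl
  y V hV n e he h₁ h₂ := by
    -- Y has its generator in degree 1, so its shift by n - 1 has it in degree n.
    obtain ⟨g, hg⟩ := exists_hom_cyclicGr (𝒜 := grading (quad k m)) (a := 1) (b := n - 1)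
      (S := {gen _ Gen.y, gen _ Gen.z + algebraMap k _ (-1)})
      (by rintro s (rfl | rfl); exacts [isHom_y _, isHom_z_add _ _]) (e := e) (by simpa using he)
      (by
        rintro s (rfl | rfl)
        · exact h₁
        · rw [MulOpposite.op_add, add_smul, op_algebraMap_smul, h₂, neg_smul, one_smul,
            add_neg_cancel])
    rw [← hg, eq_zero_of_generatesObj (hY (n - 1)) hV g]
    rfl
  generic V hV c hc h := by
    by_cases hne : ∃ i, ∃ p : (P i).carrier, p ≠ 0
    · obtain ⟨i, p, hp⟩ := hne
      have := hP i
      exact eq_zero_of_projective hp (hV i) hc h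
    -- If all members were zero, X would be trivial for the family that generates it, hence zero.
    · push Not at hne
      exfalso
      have h₁ := eq_zero_of_generatesObj (hX 0) (V := (simpleX k m).shift 0)
        (fun i g => hom_ext fun v => by rw [hne i v, map_zero, map_zero]) (𝟙 _)
      exact simpleX_ne_zero (LinearMap.congr_fun (congrArg lin h₁) (Submodule.Quotient.mk
        (1 : GWA (quad k m)) : GWA (quad k m) ⧸ Submodule.span (GWA (quad k m))ᵐᵒᵖ
        {gen (quad k m) Gen.x, gen _ Gen.z + algebraMap k _ (m : k)}))

theorem Detects.generatesCat [IsAlgClosed k] [CharZero k] {I : Type w}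
    {P : I → GrMod (grading (quad k m))} (hP : Detects P) :
    GeneratesCat fun i => (qgrπ (grading (quad k m))).obj (P i) := by
  intro M
  obtain ⟨M, rfl⟩ := qgrπ_obj_surjective M
  obtain ⟨n, s, g, hg⟩ := hP.exists_finDim_coker M
  exact ⟨n, s, _, isColimitQgrπPi fun j => P (s j), (qgrπ _).map g,
    epi_qgrπ_map_of_finDim_coker g hg⟩

end GWA

namespace GrMod

/-! ### Binary direct sums and constructions of projectives -/

section Prod

variable {k : Type u} [Field k] {R : Type u} [Ring R] [Algebra k R] {𝒜 : ℤ → Submodule k R}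

/-- The direct sum of two graded modules. -/
noncomputable def prod (M N : GrMod 𝒜) : GrMod 𝒜 := pi fun b : Bool => cond b M N

/-- The first inclusion. -/
noncomputable def inl (M N : GrMod 𝒜) : M ⟶ prod M N := inj (fun b : Bool => cond b M N) true

/-- The second inclusion. -/
noncomputable def inr (M N : GrMod 𝒜) : N ⟶ prod M N := inj (fun b : Bool => cond b M N) false

/-- Morphisms out of a direct sum of two graded modules. -/
noncomputable def prodDesc {M N L : GrMod 𝒜} (f : M ⟶ L) (g : N ⟶ L) : prod M N ⟶ L :=
  desc (M := fun b : Bool => cond b M N) (Bool.rec g f)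

theorem inl_prodDesc {M N L : GrMod 𝒜} (f : M ⟶ L) (g : N ⟶ L) : inl M N ≫ prodDesc f g = f :=
  inj_desc (M := fun b : Bool => cond b M N) _ true

theorem inr_prodDesc {M N L : GrMod 𝒜} (f : M ⟶ L) (g : N ⟶ L) : inr M N ≫ prodDesc f g = g :=
  inj_desc (M := fun b : Bool => cond b M N) _ false

theorem prod_hom_ext {M N L : GrMod 𝒜} {f g : prod M N ⟶ L} (h₁ : inl M N ≫ f = inl M N ≫ g)
    (h₂ : inr M N ≫ f = inr M N ≫ g) : f = g :=
  desc_ext (M := fun b : Bool => cond b M N) fun b => by cases b <;> assumption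

theorem projective_prod (M N : GrMod 𝒜) [hM : Projective M] [hN : Projective N] :
    Projective (prod M N) :=
  have : ∀ b : Bool, Projective (cond b M N) := fun b => by cases b <;> assumption
  projective_pi

theorem projective_self_shift [GradedAlgebra 𝒜] (n : ℤ) : Projective ((self 𝒜).shift n) where
  factors {E M} g e _ := by
    obtain ⟨v, hv⟩ := surjective_of_epi e (lin g (free1 𝒜 n))
    refine ⟨ofElem (E.proj n v) (E.proj_mem n v), free_hom_ext ?_⟩
    rw [lin_comp, LinearMap.comp_apply, lin_ofElem_free1, lin_proj, hv,
      proj_of_mem (lin_mem g (free1_mem n))]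

/-- The image of an idempotent endomorphism of a projective module is projective. -/
theorem projective_range_of_idem {F : GrMod 𝒜} [Projective F] {e : F ⟶ F} (he : e ≫ e = e) :
    Projective (range e) where
  factors {E M} g q _ := by
    refine ⟨rangeι e ≫ Projective.factorThru (toRange e ≫ g) q, ?_⟩
    rw [Category.assoc, Projective.factorThru_comp, ← Category.assoc]
    have : rangeι e ≫ toRange e = 𝟙 _ := hom_ext fun v => by
      obtain ⟨v, rfl⟩ := lin_toRange_surjective e v
      exact Subtype.ext (LinearMap.congr_fun (congrArg lin he) v)
    rw [this, Category.id_comp]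

end Prod

end GrMod

namespace GWA

open Polynomial GrMod MulOpposite

variable {k : Type u} [Field k] {m : ℕ}

local notation "𝐱" => gen (quad k m) Gen.x
local notation "𝐲" => gen (quad k m) Gen.y
local notation "𝐳" => gen (quad k m) Gen.z

/-! ### Polynomials with integral roots -/

/-- Products of linear polynomials `X + a` with `a` in a set of integers. -/
noncomputable def intFactors (k : Type u) [Field k] (S : Set ℤ) : Submonoid k[X] :=
  Submonoid.closure ((fun a : ℤ => X + C (a : k)) '' S)

theorem mem_intFactors {S : Set ℤ} {a : ℤ} (ha : a ∈ S) : X + C (a : k) ∈ intFactors k S :=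
  Submonoid.subset_closure ⟨a, ha, rfl⟩

/-- The factors X + a with a < s and X + b with b ≥ s have different roots in characteristic zero.
-/
theorem isCoprime_of_intFactors [CharZero k] {s : ℤ} {p q : k[X]}
    (hp : p ∈ intFactors k (Set.Iio s)) (hq : q ∈ intFactors k (Set.Ici s)) : IsCoprime p q := by
  induction hp using Submonoid.closure_induction with
  | one => exact isCoprime_one_left
  | mul a b _ _ ha hb => exact ha.mul_left hb
  | mem a ha =>
    obtain ⟨a, ha, rfl⟩ := ha
    induction hq using Submonoid.closure_induction with
    | one => exact isCoprime_one_right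
    | mul a b _ _ ha hb => exact ha.mul_right hb
    | mem b hb =>
      obtain ⟨b, hb, rfl⟩ := hb
      have hlt : a < b := lt_of_lt_of_le ha hb
      have hab : (-a : k) - -b ≠ 0 := by
        rw [neg_sub_neg, sub_ne_zero]
        exact fun h => hlt.ne' (Int.cast_injective h)
      simpa [sub_eq_add_neg] using isCoprime_X_sub_C_of_isUnit_sub hab.isUnit

theorem eval_ne_zero_of_intFactors {S : Set ℤ} {p : k[X]} (hp : p ∈ intFactors k S) {c : k}
    (hc : ∀ j : ℤ, c ≠ j) : p.eval c ≠ 0 := by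
  induction hp using Submonoid.closure_induction with
  | one => simp
  | mul a b _ _ ha hb => rw [eval_mul]; exact mul_ne_zero ha hb
  | mem a ha =>
    obtain ⟨a, -, rfl⟩ := ha
    simpa [add_eq_zero_iff_eq_neg] using hc (-a)

/-- The product of the polynomials `X + s + i` for `i < n`. -/
noncomputable def linProd (k : Type u) [Field k] (s : ℤ) (n : ℕ) : k[X] :=
  ∏ i ∈ Finset.range n, (X + C ((s + i : ℤ) : k))

theorem linProd_mem {S : Set ℤ} {s : ℤ} {n : ℕ} (h : ∀ i < n, s + i ∈ S) :
    linProd k s n ∈ intFactors k S :=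
  prod_mem fun i hi => mem_intFactors (h i (Finset.mem_range.1 hi))

theorem quad_comp (s : ℤ) : (quad k m).comp (X + C (s : k)) =
    (X + C (s : k)) * (X + C ((s + m : ℤ) : k)) := by
  simp [quad, add_assoc]

/-- The innermost product xy acts in degree s + n as f(w+s+n) = (w+s+n)(w+s+n+m); the two factors
extend the two products. -/
theorem op_y_pow_op_x_pow_smul {V : GrMod (grading (quad k m))} {s : ℤ} {v : V.carrier}
    (hv : v ∈ V.deg s) (n : ℕ) : op (𝐲 ^ n) • op (𝐱 ^ n) • v =
      wPoly V (linProd k s n * linProd k (s + m) n) v := by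
  induction n with
  | zero => simp [linProd]
  | succ n ih =>
    have hx : op (𝐱 ^ n) • v ∈ V.deg (s + n) := by
      simpa [Gen.wt] using V.op_smul_mem hv (SetLike.pow_mem_graded n (gen_mem (quad k m) Gen.x))
    rw [pow_succ 𝐱, pow_succ' 𝐲, op_mul_smul, op_mul_smul, ← op_mul_smul 𝐱 𝐲, x_mul_y,
      op_aeval_smul hx, ← map_smul (wPoly V _), ih, ← wPoly_mul, quad_comp, linProd, linProd,
      linProd, linProd,
      Finset.prod_range_succ, Finset.prod_range_succ, add_right_comm s (m : ℤ) (n : ℤ)]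
    refine congrArg (fun p => wPoly V p v) ?_
    ring

theorem op_x_pow_op_y_pow_smul {V : GrMod (grading (quad k m))} {s : ℤ} {v : V.carrier}
    (hv : v ∈ V.deg s) (n : ℕ) : op (𝐱 ^ n) • op (𝐲 ^ n) • v =
      wPoly V (linProd k (s - n) n * linProd k (s - n + m) n) v := by
  induction n with
  | zero => simp [linProd]
  | succ n ih =>
    have hy : op (𝐲 ^ n) • v ∈ V.deg (s - n) := by
      simpa [Gen.wt, sub_eq_add_neg] using
        V.op_smul_mem hv (SetLike.pow_mem_graded n (gen_mem (quad k m) Gen.y))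
    have hc : ((quad k m).comp (X - 1)).comp (X + C ((s - n : ℤ) : k)) =
        (quad k m).comp (X + C ((s - (n + 1 : ℕ) : ℤ) : k)) := by
      rw [comp_assoc]
      congr 1
      simp
      ring
    have h₁ : ∀ t : ℤ, linProd k (t - (n + 1 : ℕ)) (n + 1) =
        linProd k (t - n) n * (X + C ((t - (n + 1 : ℕ) : ℤ) : k)) := by
      intro t
      rw [linProd, Finset.prod_range_succ', linProd]
      congr 1
      · refine Finset.prod_congr rfl fun i _ => ?_
        congr 3
        push_cast
        ring
      · simp
    rw [pow_succ 𝐲, pow_succ' 𝐱, op_mul_smul, op_mul_smul, ← op_mul_smul 𝐲 𝐱, y_mul_x,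
      op_aeval_smul hy, ← map_smul (wPoly V _), ih, ← wPoly_mul, hc, quad_comp, h₁,
      sub_add_eq_add_sub s _ (m : ℤ), h₁, sub_add_eq_add_sub s _ (m : ℤ)]
    congr 2
    ring

theorem wPoly_linProd_eq_zero {V : GrMod (grading (quad k m))} {s : ℤ} {n i : ℕ} (hi : i < n)
    {v : V.carrier} (hv : wOp V v = (-(s + i : ℤ) : k) • v) : wPoly V (linProd k s n) v = 0 := by
  rw [linProd, ← Finset.prod_erase_mul _ _ (Finset.mem_range.2 hi), wPoly_mul,
    ← sub_neg_eq_add X, ← C_neg, wPoly_X_sub_C, hv, sub_self, map_zero]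

/-! ### Projective modules without finite-dimensional quotients -/

section Tail

variable (k m) in
/-- The free module of rank two containing `tailProj` as a direct summand. -/
noncomputable def tailFree (s : ℤ) : GrMod (grading (quad k m)) :=
  prod ((self _).shift s) ((self _).shift (s - m))

/-- The morphism out of `tailFree` given by the images of the generators. -/
noncomputable def tailFreeHom {V : GrMod (grading (quad k m))} {s : ℤ} {a b : V.carrier}
    (ha : a ∈ V.deg s) (hb : b ∈ V.deg (s - m)) : tailFree k m s ⟶ V :=
  prodDesc (ofElem a ha) (ofElem b hb)

variable (k m) in
/-- The first generator of `tailFree`. -/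
noncomputable def genA (s : ℤ) : (tailFree k m s).carrier := lin (inl _ _) (free1 _ s)

variable (k m) in
/-- The second generator of `tailFree`. -/
noncomputable def genB (s : ℤ) : (tailFree k m s).carrier := lin (inr _ _) (free1 _ (s - m))

theorem genA_mem (s : ℤ) : genA k m s ∈ (tailFree k m s).deg s := lin_mem _ (free1_mem s)

theorem genB_mem (s : ℤ) : genB k m s ∈ (tailFree k m s).deg (s - m) :=
  lin_mem _ (free1_mem (s - m))

section

variable {V : GrMod (grading (quad k m))} {s : ℤ} {a b : V.carrier}
  (ha : a ∈ V.deg s) (hb : b ∈ V.deg (s - m))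

theorem lin_tailFreeHom_genA : lin (tailFreeHom ha hb) (genA k m s) = a :=
  (LinearMap.congr_fun (congrArg lin (inl_prodDesc (ofElem a ha) (ofElem b hb))) _).trans
    (lin_ofElem_free1 a ha)

theorem lin_tailFreeHom_genB : lin (tailFreeHom ha hb) (genB k m s) = b :=
  (LinearMap.congr_fun (congrArg lin (inr_prodDesc (ofElem a ha) (ofElem b hb))) _).trans
    (lin_ofElem_free1 b hb)

theorem tailFree_hom_ext {g g' : tailFree k m s ⟶ V}
    (h₁ : lin g (genA k m s) = lin g' (genA k m s))
    (h₂ : lin g (genB k m s) = lin g' (genB k m s)) : g = g' :=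
  prod_hom_ext (free_hom_ext h₁) (free_hom_ext h₂)

include ha in
theorem op_y_pow_smul_mem : op (𝐲 ^ m) • a ∈ V.deg (s - m) := by
  simpa [Gen.wt, sub_eq_add_neg] using
    V.op_smul_mem ha (SetLike.pow_mem_graded m (gen_mem (quad k m) Gen.y))

include hb in
theorem op_x_pow_smul_mem : op (𝐱 ^ m) • b ∈ V.deg s := by
  simpa [Gen.wt] using V.op_smul_mem hb (SetLike.pow_mem_graded m (gen_mem (quad k m) Gen.x))

include hb in
theorem op_y_pow_op_x_pow_smul_tail : op (𝐲 ^ m) • op (𝐱 ^ m) • b =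
    wPoly V (linProd k (s - m) m * linProd k s m) b := by
  rw [op_y_pow_op_x_pow_smul hb, sub_add_cancel]

include ha in
theorem op_x_pow_op_y_pow_smul_tail : op (𝐱 ^ m) • op (𝐲 ^ m) • a =
    wPoly V (linProd k (s - m) m * linProd k s m) a := by
  rw [op_x_pow_op_y_pow_smul ha, sub_add_cancel]

end

variable [CharZero k]

variable (k m) in
-- The two products are the factors of the action of x^m y^m in degree s - m. Their constants lie in
-- [s-m, s) and [s, s+m), hence they are coprime.
theorem exists_bezout (s : ℤ) : ∃ u v : k[X], u * linProd k (s - m) m + v * linProd k s m = 1 :=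
  isCoprime_of_intFactors (s := s)
    (linProd_mem fun i hi => by simp only [Set.mem_Iio]; omega)
    (linProd_mem fun i hi => by simp only [Set.mem_Ici]; omega)

variable (k m) in
/-- A Bézout coefficient. -/
noncomputable def bezU (s : ℤ) : k[X] := (exists_bezout k m s).choose

variable (k m) in
/-- A Bézout coefficient. -/
noncomputable def bezV (s : ℤ) : k[X] := (exists_bezout k m s).choose_spec.choose

variable (k m) in
theorem bezout (s : ℤ) : bezU k m s * linProd k (s - m) m + bezV k m s * linProd k s m = 1 :=
  (exists_bezout k m s).choose_spec.choose_spec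

variable (k m) in
/-- The idempotent endomorphism of `tailFree` defining `tailProj`. -/
noncomputable def tailIdem (s : ℤ) : tailFree k m s ⟶ tailFree k m s :=
  tailFreeHom
    (a := wPoly _ (bezV k m s * linProd k s m) (genA k m s) +
      wPoly _ (bezU k m s) (op (𝐱 ^ m) • genB k m s))
    (b := wPoly _ (bezU k m s * linProd k (s - m) m) (genB k m s) +
      wPoly _ (bezV k m s) (op (𝐲 ^ m) • genA k m s))
    (add_mem (wPoly_mem (genA_mem s) _) (wPoly_mem (op_x_pow_smul_mem (genB_mem s)) _))
    (add_mem (wPoly_mem (genB_mem s) _) (wPoly_mem (op_y_pow_smul_mem (genA_mem s)) _))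

theorem lin_tailIdem_genA {V : GrMod (grading (quad k m))} {s : ℤ} (g : tailFree k m s ⟶ V) :
    lin (tailIdem k m s ≫ g) (genA k m s) =
      wPoly V (bezV k m s * linProd k s m) (lin g (genA k m s)) +
        wPoly V (bezU k m s) (op (𝐱 ^ m) • lin g (genB k m s)) := by
  rw [lin_comp, LinearMap.comp_apply, tailIdem, lin_tailFreeHom_genA, map_add, lin_wPoly, lin_wPoly,
    map_smul]

theorem lin_tailIdem_genB {V : GrMod (grading (quad k m))} {s : ℤ} (g : tailFree k m s ⟶ V) :
    lin (tailIdem k m s ≫ g) (genB k m s) =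
      wPoly V (bezU k m s * linProd k (s - m) m) (lin g (genB k m s)) +
        wPoly V (bezV k m s) (op (𝐲 ^ m) • lin g (genA k m s)) := by
  rw [lin_comp, LinearMap.comp_apply, tailIdem, lin_tailFreeHom_genB, map_add, lin_wPoly, lin_wPoly,
    map_smul]

/-- The morphisms fixed by `tailIdem` are described by two relations. -/
theorem tailIdem_comp_eq_iff {V : GrMod (grading (quad k m))} {s : ℤ} (g : tailFree k m s ⟶ V) :
    tailIdem k m s ≫ g = g ↔
      op (𝐱 ^ m) • lin g (genB k m s) = wPoly V (linProd k (s - m) m) (lin g (genA k m s)) ∧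
      op (𝐲 ^ m) • lin g (genA k m s) = wPoly V (linProd k s m) (lin g (genB k m s)) := by
  have hA := lin_tailIdem_genA g
  have hB := lin_tailIdem_genB g
  have ha := lin_mem g (genA_mem (k := k) (m := m) s)
  have hb := lin_mem g (genB_mem (k := k) (m := m) s)
  constructor
  -- Write g, h for the two products, with ug + vh = 1. Applying x^m to b = ugb + v(a y^m) and using
  -- a y^m x^m = gha gives b x^m = g(u(b x^m) + vha) = ga; the other relation is symmetric.
  · intro h
    rw [h] at hA hB
    constructor
    · conv_lhs => rw [hB, smul_add, ← map_smul (wPoly V _), ← map_smul (wPoly V _),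
        op_x_pow_op_y_pow_smul_tail ha]
      conv_rhs => rw [hA, map_add, ← wPoly_mul, ← wPoly_mul]
      rw [← wPoly_mul, add_comm]
      congr 3 <;> ring
    · conv_lhs => rw [hA, smul_add, ← map_smul (wPoly V _), ← map_smul (wPoly V _),
        op_y_pow_op_x_pow_smul_tail hb]
      conv_rhs => rw [hB, map_add, ← wPoly_mul, ← wPoly_mul]
      rw [← wPoly_mul, add_comm]
      congr 3 <;> ring
  · rintro ⟨h₁, h₂⟩
    refine tailFree_hom_ext ?_ ?_
    · rw [hA, h₁, ← wPoly_mul, ← LinearMap.add_apply, ← map_add, add_comm, bezout, map_one]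
      rfl
    · rw [hB, h₂, ← wPoly_mul, ← LinearMap.add_apply, ← map_add, bezout, map_one]
      rfl

/-- The images of the two generators satisfy the relations of `tailIdem_comp_eq_iff`, again because
x^m y^m and y^m x^m both act as the product of the two factors. -/
theorem tailIdem_idem (s : ℤ) : tailIdem k m s ≫ tailIdem k m s = tailIdem k m s := by
  rw [tailIdem_comp_eq_iff]
  have hA : lin (tailIdem k m s) (genA k m s) = _ := lin_tailFreeHom_genA _ _
  have hB : lin (tailIdem k m s) (genB k m s) = _ := lin_tailFreeHom_genB _ _
  have ha := genA_mem (k := k) (m := m) s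
  have hb := genB_mem (k := k) (m := m) s
  constructor
  · rw [hA, hB, smul_add, ← map_smul, ← map_smul, op_x_pow_op_y_pow_smul_tail ha, map_add,
      ← wPoly_mul, ← wPoly_mul, ← wPoly_mul, add_comm]
    congr 3 <;> ring
  · rw [hA, hB, smul_add, ← map_smul, ← map_smul, op_y_pow_op_x_pow_smul_tail hb, map_add,
      ← wPoly_mul, ← wPoly_mul, ← wPoly_mul, add_comm]
    congr 3 <;> ring

variable (k m) in
/-- The projective module with generators `a`, `b` of degrees `s`, `s - m` and the relations that
`b x ^ m` and `a y ^ m` are the products of `a` and `b` with complementary factors of the action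
of `x ^ m y ^ m`. -/
noncomputable def tailProj (s : ℤ) : GrMod (grading (quad k m)) := range (tailIdem k m s)

theorem projective_tailProj (s : ℤ) : Projective (tailProj k m s) := by
  have := projective_self_shift (𝒜 := grading (quad k m)) s
  have := projective_self_shift (𝒜 := grading (quad k m)) (s - m)
  have : Projective (tailFree k m s) := projective_prod _ _
  exact projective_range_of_idem (tailIdem_idem s)

/-- In a finite-dimensional module a is killed by a power of x, hence by a polynomial in w with
constants at least s, and b by a power of y, hence by one with constants below s. The relations
transfer each annihilator to the other generator without leaving its side of s, and coprimality
finishes. -/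
theorem tailProj_hom_eq_zero_of_finDim {V : GrMod (grading (quad k m))} (hV : V.FinDim) (s : ℤ)
    (g : tailProj k m s ⟶ V) : g = 0 := by
  revert g
  unfold tailProj
  intro g
  let G : tailFree k m s ⟶ V := toRange (tailIdem k m s) ≫ g
  have hG : tailIdem k m s ≫ G = G := by
    have : tailIdem k m s ≫ toRange (tailIdem k m s) = toRange (tailIdem k m s) :=
      hom_ext fun v => Subtype.ext (LinearMap.congr_fun (congrArg lin (tailIdem_idem s)) v)
    change tailIdem k m s ≫ toRange (tailIdem k m s) ≫ g = toRange (tailIdem k m s) ≫ g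
    rw [← Category.assoc, this]
  obtain ⟨h₁, h₂⟩ := (tailIdem_comp_eq_iff G).1 hG
  obtain ⟨B, hB⟩ := IsBounded.of_finDim hV
  have ha := lin_mem G (genA_mem (k := k) (m := m) s)
  have hb := lin_mem G (genB_mem (k := k) (m := m) s)
  -- Ensures s + N > B and s - m - N < -B, so that a x^N and b y^N fall outside the support.
  let N : ℕ := (B + |s| + |s - m| + 1).toNat
  have hN : B + |s| + |s - m| + 1 ≤ N := Int.self_le_toNat _
  have hs := abs_le.1 (le_refl |s|)
  have hs' := abs_le.1 (le_refl |s - m|)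
  have hx : op (𝐱 ^ N) • lin G (genA k m s) = 0 := by
    refine hB (s + N) (lt_abs.2 (Or.inl (by linarith [abs_nonneg (s - m)]))) _ ?_
    simpa [Gen.wt] using V.op_smul_mem ha (SetLike.pow_mem_graded N (gen_mem (quad k m) Gen.x))
  have hy : op (𝐲 ^ N) • lin G (genB k m s) = 0 := by
    refine hB (s - m - N) (lt_abs.2 (Or.inr (by linarith [abs_nonneg s]))) _ ?_
    simpa [Gen.wt, sub_eq_add_neg] using
      V.op_smul_mem hb (SetLike.pow_mem_graded N (gen_mem (quad k m) Gen.y))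
  have hA := op_y_pow_op_x_pow_smul ha N
  have hB := op_x_pow_op_y_pow_smul hb N
  rw [hx, smul_zero] at hA
  rw [hy, smul_zero] at hB
  have memA : linProd k s N * linProd k (s + m) N ∈ intFactors k (Set.Ici s) :=
    mul_mem (linProd_mem fun i hi => by simp only [Set.mem_Ici]; omega)
      (linProd_mem fun i hi => by simp only [Set.mem_Ici]; omega)
  have memB : linProd k (s - m - N) N * linProd k (s - m - N + m) N ∈ intFactors k (Set.Iio s) :=
    mul_mem (linProd_mem fun i hi => by simp only [Set.mem_Iio]; omega)
      (linProd_mem fun i hi => by simp only [Set.mem_Iio]; omega)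
  have memg : linProd k (s - m) m ∈ intFactors k (Set.Iio s) :=
    linProd_mem fun i hi => by simp only [Set.mem_Iio]; omega
  have memh : linProd k s m ∈ intFactors k (Set.Ici s) :=
    linProd_mem fun i hi => by simp only [Set.mem_Ici]; omega
  have key : ∀ {p q : k[X]} {v : V.carrier}, IsCoprime p q → wPoly V p v = 0 → wPoly V q v = 0 →
      v = 0 := by
    rintro p q v ⟨a, b, hab⟩ hp hq
    have h := congrArg (fun p => wPoly V p v) hab
    simp only [map_add, LinearMap.add_apply, wPoly_mul, hp, hq, map_zero, add_zero, map_one,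
      Module.End.one_apply] at h
    exact h.symm
  -- The annihilator of b also kills b x^m = g(w)a; multiplied by g it kills a and still has all
  -- constants below s.
  have ha0 : lin G (genA k m s) = 0 := by
    refine key (isCoprime_of_intFactors (mul_mem memB memg) memA) ?_ hA.symm
    rw [wPoly_mul, ← h₁, map_smul, ← hB, smul_zero]
  have hb0 : lin G (genB k m s) = 0 := by
    refine key (isCoprime_of_intFactors memB (mul_mem memA memh)) hB.symm ?_
    rw [wPoly_mul, ← h₂, map_smul, ← hA, smul_zero]
  have hG0 : G = 0 := tailFree_hom_ext ha0 hb0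
  have := epi_of_surjective _ (lin_toRange_surjective (tailIdem k m s))
  rw [← cancel_epi (toRange (tailIdem k m s)), Limits.comp_zero]
  exact hG0

/-- Two elements satisfying the relations define a morphism on `tailFree` fixed by the idempotent,
so it factors through `tailProj`. -/
theorem eq_zero_of_tailProj {V : GrMod (grading (quad k m))} {s : ℤ}
    (hV : ∀ g : tailProj k m s ⟶ V, g = 0) {a b : V.carrier} (ha : a ∈ V.deg s)
    (hb : b ∈ V.deg (s - m)) (h₁ : op (𝐱 ^ m) • b = wPoly V (linProd k (s - m) m) a)
    (h₂ : op (𝐲 ^ m) • a = wPoly V (linProd k s m) b) : a = 0 ∧ b = 0 := by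
  let G := tailFreeHom ha hb
  have hG : tailIdem k m s ≫ G = G := by
    rw [tailIdem_comp_eq_iff, lin_tailFreeHom_genA, lin_tailFreeHom_genB]
    exact ⟨h₁, h₂⟩
  have h0 : rangeι (tailIdem k m s) ≫ G = 0 := hV _
  have hG0 : G = 0 :=
    calc
      G = toRange (tailIdem k m s) ≫ rangeι (tailIdem k m s) ≫ G := by
        rw [← Category.assoc, toRange_rangeι, hG]
      _ = 0 := by rw [h0, Limits.comp_zero]
  constructor
  · rw [← lin_tailFreeHom_genA ha hb]
    exact LinearMap.congr_fun (congrArg lin hG0) _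
  · rw [← lin_tailFreeHom_genB ha hb]
    exact LinearMap.congr_fun (congrArg lin hG0) _

theorem detects_tailProj (hm : 0 < m) : Detects (tailProj k m) where
  projective := projective_tailProj
  x V hV n e he h₁ h₂ := by
    -- Take a = 0 and b = e, so s = n + m. Here w e = -(m+n)e = -s e, a root of the first factor (i
    -- = 0) of `linProd k s m`.
    refine (eq_zero_of_tailProj (hV (n + m)) (zero_mem _) (by simpa using he) ?_ ?_).2
    · rw [← mul_pow_sub_one hm.ne' 𝐱, op_mul_smul, h₁, smul_zero, map_zero]
    · rw [smul_zero, wPoly_linProd_eq_zero hm]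
      rw [wOp_of_mem he, h₂, ← sub_smul]
      congr 1
      push_cast
      ring
  y V hV n e he h₁ h₂ := by
    -- Take a = e, b = 0 and s = n. Here w e = (1-n)e, a root of the last factor (i = m - 1) of
    -- `linProd k (s - m) m`.
    refine (eq_zero_of_tailProj (hV n) he (zero_mem _) ?_ ?_).1
    · rw [smul_zero, wPoly_linProd_eq_zero (Nat.sub_lt hm one_pos)]
      rw [wOp_of_mem he, h₂, Nat.cast_pred hm]
      push_cast
      module
    · rw [← mul_pow_sub_one hm.ne' 𝐲, op_mul_smul, h₁, smul_zero, map_zero]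
  generic V hV c hc h v := by
    -- For nonintegral c the value h(c) of the second product is invertible, so any a of degree s
    -- extends to a pair with b = h(c)⁻¹ a y^m.
    refine eq_zero_of_proj fun s => ?_
    have ha := V.proj_mem s v
    have hne : (linProd k s m).eval c ≠ 0 :=
      eval_ne_zero_of_intFactors (linProd_mem (S := Set.univ) fun _ _ => trivial) hc
    refine (eq_zero_of_tailProj (hV s) ha
      (b := ((linProd k s m).eval c)⁻¹ • op (𝐲 ^ m) • V.proj s v)
      (Submodule.smul_mem _ _ (op_y_pow_smul_mem ha)) ?_ ?_).1
    · rw [op_smul_smul, op_x_pow_op_y_pow_smul_tail ha, wPoly_of_scalar h, wPoly_of_scalar h,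
        smul_smul, eval_mul, mul_comm, mul_assoc, mul_inv_cancel₀ hne, mul_one]
    · rw [wPoly_of_scalar h, smul_smul, mul_inv_cancel₀ hne, one_smul]

end Tail

/-- Finite sums of the modules `tailProj` cover any M up to a finite-dimensional cokernel, and they
stay projective in the quotient because they have no nonzero maps to finite-dimensional modules. -/
theorem enoughProjectives_qgr [IsAlgClosed k] [CharZero k] (hm : 0 < m) :
    EnoughProjectives (Qgr (grading (quad k m))) := by
  refine ⟨fun M => ?_⟩
  obtain ⟨M, rfl⟩ := qgrπ_obj_surjective M
  have hP := detects_tailProj (k := k) hm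
  obtain ⟨n, s, g, hg⟩ := hP.exists_finDim_coker M
  have := hP.projective
  have hproj : Projective ((qgrπ (grading (quad k m))).obj (pi fun j => tailProj k m (s j))) :=
    projective_qgrπ_obj fun V hV f => desc_ext fun j => by
      rw [Limits.comp_zero]
      exact tailProj_hom_eq_zero_of_finDim hV _ _
  exact ⟨{ p := _
           projective := hproj
           f := (qgrπ _).map g
           epi := epi_qgrπ_map_of_finDim_coker g hg }⟩

end GWA

theorem mainTheorem12 (k : Type u) [Field k] [IsAlgClosed k] [CharZero k] (m : ℕ) (hm : 0 < m) :
    (∀ (I : Type w) (P : I → GrMod (GWA.grading (GWA.quad k m))),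
      (∀ i, Projective (P i) ∧ (P i).IsRankOne) →
      (∀ n : ℤ, GeneratesObj P ((GWA.simpleX k m).shift n)) →
      (∀ n : ℤ, GeneratesObj P ((GWA.simpleY k m).shift n)) →
      GeneratesCat fun i => (qgrπ (GWA.grading (GWA.quad k m))).obj (P i)) ∧
    EnoughProjectives (Qgr (GWA.grading (GWA.quad k m))) :=
  ⟨fun _ _ hP hX hY => (GWA.detects_of_generates (fun i => (hP i).1) hX hY).generatesCat,
    GWA.enoughProjectives_qgr hm⟩
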